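/- Let $G=(V,E)$ be any graph (possibly infinite and disconnected), let $\mathcal X$ be the set of finite subsets of $V$ and, for $X\in\mathcal X$, let $\mathcal C_X$ be the set of components of $G-X$. For $X\subseteq X'\in\mathcal X$ let $c_{X',X}:\mathcal C_{X'}\to\mathcal C_X$ send each component of $G-X'$ to the component of $G-X$ including it. For $\mathcal C\subseteq\mathcal C_X$ let $V[\mathcal C]$ be the set of vertices of the components in $\mathcal C$. *Ends.* $\Omega$ is the set of ends of $G$: the equivalence classes of rays (one-way infinite paths), where two rays are equivalent if for every $X\in\mathcal X$ both have a tail in the same component of $G-X$. For $\omega\in\Omega$, $C(X,\omega)$ is the component of $G-X$ in which every ray of $\omega$ has a tail. *$\mathcal C$-systems.* A $\mathcal C$-system $\mathcal C^\alpha=\{(\alpha(\mathcal C_X),\alpha_X),a_{X',X}\}$ is an inverse system, indexed by $\mathcal X$ (ordered by inclusion), of Hausdorff compactifications $\alpha_X:\mathcal C_X\hookrightarrow\alpha(\mathcal C_X)$ of the discrete spaces $\mathcal C_X$ with continuous bonding maps satisfying $a_{X',X}\circ\alpha_{X'}=\alpha_X\circ c_{X',X}$. Its inverse limit contains $\Omega$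 via $\omega\mapsto(\alpha_X(C(X,\omega)))_X$. Write $\mathcal C^\alpha\le\mathcal C^\delta$ if there are continuous maps $f_X:\delta(\mathcal C_X)\to\alpha(\mathcal C_X)$, for all $X\in\mathcal X$, with $f_X\circ\delta_X=\alpha_X$ that commute with the bonding maps; $\mathcal C^\alpha$ and $\mathcal C^\delta$ are *$\mathcal C$-equivalent* if $\mathcal C^\alpha\le\mathcal C^\delta\le\mathcal C^\alpha$. $\mathcal C^{\mathcal U}$ is the $\mathcal C$-system of the Stone–Čech compactifications $\beta(\mathcal C_X)$, that is, of the spaces of ultrafilters on $\mathcal C_X$, with bonding maps $\beta(c_{X',X})$; its inverse limit is $\mathcal U$. A set $Y\in\mathcal X$ is *critical* if infinitely many components of $G-Y$ have neighbourhood precisely $Y$. $\mathcal C^\Gamma$ is the $\mathcal C$-system of the spaces $\Gamma_X=\mathcal C_X\sqcup\{Y\subseteq X: Y\text{ critical}\}$, whose topology is generated by all subsets of $\mathcal C_X$ and all sets $\mathcal C\sqcup\{Y\}$ with $Y\subseteq X$ critical and $\mathcal C$ a cofinite subset of the set of those $C\in\mathcal C_X$ with $N(C)=Y$; its bonding maps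 $\Gamma_{X'}\to\Gamma_X$ extend $c_{X',X}$, fix every critical $Y\subseteq X$, and send every other critical $Y\subseteq X'$ to the unique component of $G-X$ meeting $Y$. Its inverse limit is $\Gamma$. *Tangles.* A finite order separation is a set $\{A,B\}$ with $A\cup B=V$, $A\cap B$ finite and no edge of $G$ between $A\setminus B$ and $B\setminus A$; its orientations are $(A,B)$ and $(B,A)$, ordered by $(A,B)\le(C,D)$ if $A\subseteq C$ and $B\supseteq D$. An *$\aleph_0$-tangle* is a set $\tau$ of such oriented separations containing precisely one orientation of every finite order separation, such that no two distinct $(B,A),(C,D)\in\tau$ satisfy $(A,B)<(C,D)$, and such that $\tau$ includes no finite star of finite interior. Here a star is a set $\sigma$ of oriented finite order separations such that every two distinct $(A,B),(D,C)\in\sigma$ satisfy $(A,B)\le(C,D)$, and its interior is $\bigcap_{(A,B)\in\sigma}B$ (which is $V$ if $\sigma=\emptyset$). $\Theta$ is the set of $\aleph_0$-tangles. Every end $\omega$ is identified with its end tangle $\tau_\omega=\{(A,B): C(A\cap B,\omega)\subseteq G[B\setminus A]\}\in\Theta$. *Compactifications.* Let $G$ also denote the 1-complex of $G$, in which the basic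 open neighbourhoods of a vertex $v$ are the unions $\bigcup_{e\ni v}[v,i_e)$ for arbitrary choices of inner points $i_e$ of the edges $e$ at $v$. For $\mathcal C\subseteq\mathcal C_X$ let $R(X,\mathcal C)\subseteq G$ consist of all vertices and inner edge points of the components in $\mathcal C$ and all inner points of the edges between $X$ and $V[\mathcal C]$. The space $|G|_\Gamma=G\sqcup\Gamma$ has the topology generated by the open sets of $G$ and the sets $R(X,O\cap\mathcal C_X)\cup\{\xi\in\Gamma:\xi_X\in O\}$ for $X\in\mathcal X$ and $O\subseteq\Gamma_X$ open. The space $|G|_\Theta=G\sqcup\Theta$ has the topology generated by the open sets of $G$ and the sets $R(X,\mathcal C)\cup\{\tau\in\Theta:(V\setminus V[\mathcal C],\,X\cup V[\mathcal C])\in\tau\}$ for $X\in\mathcal X$ and $\mathcal C\subseteq\mathcal C_X$. Both contain $G\sqcup\Omega$ canonically; they are *topologically equivalent* if there is a homeomorphism $|G|_\Theta\to|G|_\Gamma$ fixing $G\sqcup\Omega$ pointwise. **Theorem.** For every graph $G$ the following are equivalent: 1. $|G|_\Gamma$ and $|G|_\Theta$ are topologically equivalent; 2. the $\mathcal C$-systems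 $\mathcal C^\Gamma$ and $\mathcal C^{\mathcal U}$ are $\mathcal C$-equivalent; 3. $G$ is *tough*: $\mathcal C_X$ is finite for every finite $X\subseteq V$; 4. $\Omega=\Gamma=\mathcal U$, that is, the canonical maps $\Omega\to\Gamma$ and $\Omega\to\mathcal U$ are bijections; 5. $\Omega=\Theta$, that is, $\omega\mapsto\tau_\omega$ is a bijection $\Omega\to\Theta$: all $\aleph_0$-tangles are ends. -/

import Mathlib

open Set Topology

universe u

noncomputable section

namespace EndsTangles

variable {V : Type u}

/-! ### Components, neighbourhoods, toughness -/

/-- `𝒞_X`, the set of components of `G - X`, for a finite set `X` of vertices. -/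
abbrev Comp (G : SimpleGraph V) (X : Finset V) : Type u := G.ComponentCompl (X : Set V)

/-- `𝔠_{X',X} : 𝒞_{X'} → 𝒞_X` sends a component of `G - X'` to the component of `G - X`
including it. -/
def compMap (G : SimpleGraph V) {X X' : Finset V} (h : X ⊆ X') (C : Comp G X') : Comp G X :=
  SimpleGraph.ComponentCompl.hom (Finset.coe_subset.2 h) C

/-- `V[𝒞]`, the set of vertices of the components in `𝒞`. -/
def vertsOf {G : SimpleGraph V} {X : Finset V} (𝒞 : Set (Comp G X)) : Set V :=
  {v | ∃ C ∈ 𝒞, v ∈ C}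

/-- The neighbourhood `N(C)` of a set `C` of vertices. -/
def nbhd (G : SimpleGraph V) (C : Set V) : Set V := {v | v ∉ C ∧ ∃ c ∈ C, G.Adj c v}

/-- `G` is tough: deleting any finite set of vertices leaves only finitely many components. -/
def IsTough (G : SimpleGraph V) : Prop := ∀ X : Finset V, Finite (Comp G X)

/-- `𝒞_X(Y)`, the set of components of `G - X` whose neighbourhood is precisely `Y`. -/
def compsWithNbhd (G : SimpleGraph V) (X Y : Finset V) : Set (Comp G X) :=
  {C | nbhd G (C : Set V) = (Y : Set V)}

/-- A finite set `X` of vertices is critical if infinitely many components of `G - X` have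
neighbourhood precisely `X`. -/
def IsCritical (G : SimpleGraph V) (X : Finset V) : Prop := (compsWithNbhd G X X).Infinite

lemma compMap_refl (G : SimpleGraph V) {X : Finset V} (C : Comp G X) :
    compMap G (Finset.Subset.refl X) C = C :=
  SimpleGraph.ComponentCompl.hom_refl C

lemma compMap_trans (G : SimpleGraph V) {X X' X'' : Finset V} (h : X ⊆ X') (h' : X' ⊆ X'')
    (C : Comp G X'') : compMap G (h.trans h') C = compMap G h (compMap G h' C) :=
  SimpleGraph.ComponentCompl.hom_trans C (Finset.coe_subset.2 h') (Finset.coe_subset.2 h)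

lemma subset_compMap (G : SimpleGraph V) {X X' : Finset V} (h : X ⊆ X') (C : Comp G X') :
    (C : Set V) ⊆ (compMap G h C : Set V) :=
  SimpleGraph.ComponentCompl.subset_hom C (Finset.coe_subset.2 h)

lemma comp_eq_of_mem {G : SimpleGraph V} {X : Finset V} {C D : Comp G X} {v : V}
    (hC : v ∈ C) (hD : v ∈ D) : C = D := by
  obtain ⟨h1, rfl⟩ := hC
  obtain ⟨h2, rfl⟩ := hD
  rfl

/-- A component is included in every set that it meets and that is closed, within the component,
under taking neighbours. -/
lemma comp_subset_of_closed {G : SimpleGraph V} {X : Finset V} (C : Comp G X) (S : Set V) {v : V}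
    (hv : v ∈ C) (hvS : v ∈ S)
    (hS : ∀ a b, a ∈ C → a ∈ S → b ∈ C → G.Adj a b → b ∈ S) : (C : Set V) ⊆ S := by
  obtain ⟨hvX, rfl⟩ := hv
  rintro w ⟨hwX, hw⟩
  rw [SimpleGraph.ConnectedComponent.eq] at hw
  obtain ⟨p⟩ := hw.symm
  have key : ∀ (a b : ((X : Set V)ᶜ : Set V)) (_ : (G.induce ((X : Set V)ᶜ)).Walk a b),
      (a : V) ∈ G.componentComplMk hvX → (a : V) ∈ S → (b : V) ∈ S := by
    intro a b q
    induction q with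
    | nil => exact fun _ h => h
    | cons hadj q ih =>
      intro ha haS
      rename_i a b c
      have hadj' : G.Adj (a : V) (b : V) := hadj
      have hb : (b : V) ∈ G.componentComplMk hvX :=
        SimpleGraph.ComponentCompl.mem_of_adj _ _ ha b.2 hadj'
      exact ih hb (hS _ _ ha haS hb hadj')
  exact key _ _ p ⟨hvX, rfl⟩ hvS

/-- If `N(C) = Y ⊆ X` for a component `C` of `G - X'` with `X ⊆ X'`, then `C` is also a component
of `G - X`. -/
lemma coe_compMap_of_nbhd {G : SimpleGraph V} {X X' Y : Finset V} (h : X ⊆ X') (hY : Y ⊆ X)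
    {C : Comp G X'} (hC : C ∈ compsWithNbhd G X' Y) : (compMap G h C : Set V) = C := by
  refine Subset.antisymm ?_ (subset_compMap G h C)
  obtain ⟨v, hv⟩ := SimpleGraph.ComponentCompl.nonempty C
  refine comp_subset_of_closed _ _ (subset_compMap G h C hv) hv ?_
  intro a b _ haC hb hab
  by_contra hbC
  have : b ∈ nbhd G (C : Set V) := ⟨hbC, a, haC, hab⟩
  rw [show nbhd G (C : Set V) = (Y : Set V) from hC] at this
  exact SimpleGraph.ComponentCompl.notMem_of_mem hb (hY this)

lemma compMap_mem_compsWithNbhd {G : SimpleGraph V} {X X' Y : Finset V} (h : X ⊆ X') (hY : Y ⊆ X)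
    {C : Comp G X'} (hC : C ∈ compsWithNbhd G X' Y) : compMap G h C ∈ compsWithNbhd G X Y := by
  change nbhd G (compMap G h C : Set V) = _
  rw [coe_compMap_of_nbhd h hY hC]
  exact hC

lemma compMap_injOn {G : SimpleGraph V} {X X' Y : Finset V} (h : X ⊆ X') (hY : Y ⊆ X) :
    InjOn (compMap G h) (compsWithNbhd G X' Y) := by
  intro C hC D hD hCD
  apply SetLike.coe_injective
  rw [← coe_compMap_of_nbhd h hY hC, ← coe_compMap_of_nbhd h hY hD, hCD]

/-- Only finitely many components of `G - Y` meet the finite set `X`. -/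
lemma finite_comps_meeting (G : SimpleGraph V) (X Y : Finset V) :
    {D : Comp G Y | ∃ x ∈ X, x ∈ D}.Finite := by
  have : {D : Comp G Y | ∃ x ∈ X, x ∈ D} ⊆ ⋃ x ∈ (X : Set V), {D : Comp G Y | x ∈ D} := by
    rintro D ⟨x, hx, hxD⟩
    simp only [mem_iUnion]
    exact ⟨x, hx, hxD⟩
  refine (X.finite_toSet.biUnion fun x _ => ?_).subset this
  exact Set.Subsingleton.finite fun C hC D hD => comp_eq_of_mem hC hD

/-- A component of `G - Y` avoiding `X` is included in a component of `G - X`. -/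
lemma exists_comp_of_avoids {G : SimpleGraph V} {X Y : Finset V} (D : Comp G Y)
    (hD : ∀ x ∈ X, x ∉ D) : ∃ C : Comp G X, (D : Set V) ⊆ C := by
  obtain ⟨v, hv⟩ := SimpleGraph.ComponentCompl.nonempty D
  have hvX : v ∉ (X : Set V) := fun h => hD v h hv
  refine ⟨G.componentComplMk hvX, comp_subset_of_closed D _ hv ⟨hvX, rfl⟩ ?_⟩
  intro a b _ haC hb hab
  exact SimpleGraph.ComponentCompl.mem_of_adj _ _ haC (fun h => hD b h hb) hab

lemma compsWithNbhd_infinite_iff {G : SimpleGraph V} {X Y : Finset V} (hY : Y ⊆ X) :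
    (compsWithNbhd G X Y).Infinite ↔ IsCritical G Y := by
  constructor
  · intro h
    refine (h.image (compMap_injOn hY (Finset.Subset.refl Y))).mono ?_
    rintro _ ⟨C, hC, rfl⟩
    exact compMap_mem_compsWithNbhd hY (Finset.Subset.refl Y) hC
  · intro h
    have h1 := h.sdiff (finite_comps_meeting G X Y)
    refine Set.Infinite.of_image (compMap G hY) (h1.mono ?_)
    rintro D ⟨hD, hDX⟩
    have hDX' : ∀ x ∈ X, x ∉ D := fun x hx hxD => hDX ⟨x, hx, hxD⟩
    obtain ⟨C, hDC⟩ := exists_comp_of_avoids D hDX'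
    obtain ⟨v, hv⟩ := SimpleGraph.ComponentCompl.nonempty D
    have hCD : compMap G hY C = D :=
      comp_eq_of_mem (subset_compMap G hY C (hDC hv)) hv
    have hCeq : (C : Set V) = D := Subset.antisymm (hCD ▸ subset_compMap G hY C) hDC
    refine ⟨C, ?_, hCD⟩
    change nbhd G (C : Set V) = _
    rw [hCeq]
    exact hD

/-- If `Y` is critical and does not lie in `X`, all the vertices of `Y` outside `X` lie in the same
component of `G - X`. -/
lemma critical_same_comp {G : SimpleGraph V} {X Y : Finset V} (hY : IsCritical G Y) {y y' : V}
    (hy : y ∈ Y) (hy' : y' ∈ Y) (hyX : y ∉ (X : Set V)) (hyX' : y' ∉ (X : Set V)) :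
    G.componentComplMk hyX = G.componentComplMk hyX' := by
  obtain ⟨D, hD, hDX⟩ := (hY.sdiff (finite_comps_meeting G X Y)).nonempty
  have hDX' : ∀ x ∈ X, x ∉ D := fun x hx hxD => hDX ⟨x, hx, hxD⟩
  obtain ⟨C, hDC⟩ := exists_comp_of_avoids D hDX'
  have key : ∀ z (hz : z ∈ Y) (hzX : z ∉ (X : Set V)), z ∈ C := by
    intro z hz hzX
    have hz' : z ∈ nbhd G (D : Set V) := by
      rw [show nbhd G (D : Set V) = (Y : Set V) from hD]
      exact hz
    obtain ⟨_, c, hc, hcz⟩ := hz'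
    exact SimpleGraph.ComponentCompl.mem_of_adj _ _ (hDC hc) hzX hcz
  exact (comp_eq_of_mem (key y hy hyX) ⟨hyX, rfl⟩).symm.trans
    (comp_eq_of_mem (key y' hy' hyX') ⟨hyX', rfl⟩)

/-- `C_X(Y)`: the component of `G - X` that meets `Y`, for a set `Y` not included in `X`. It is
defined through an arbitrarily chosen vertex of `Y` outside `X`; for critical `Y` it does not
depend on that choice. -/
def compMeeting (G : SimpleGraph V) {X Y : Finset V} (h : ¬ Y ⊆ X) : Comp G X :=
  G.componentComplMk (K := (X : Set V)) (v := (Finset.not_subset.1 h).choose)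
    (Finset.not_subset.1 h).choose_spec.2

lemma compMeeting_eq {G : SimpleGraph V} {X Y : Finset V} (h : ¬ Y ⊆ X) (hY : IsCritical G Y)
    {C : Comp G X} {y : V} (hy : y ∈ Y) (hyC : y ∈ C) : compMeeting G h = C := by
  obtain ⟨hyX, rfl⟩ := hyC
  exact critical_same_comp hY (Finset.not_subset.1 h).choose_spec.1 hy _ hyX

lemma exists_mem_compMeeting (G : SimpleGraph V) {X Y : Finset V} (h : ¬ Y ⊆ X) :
    ∃ y ∈ Y, y ∈ compMeeting G h :=
  ⟨_, (Finset.not_subset.1 h).choose_spec.1, ⟨(Finset.not_subset.1 h).choose_spec.2, rfl⟩⟩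

/-! ### Ends -/

/-- A ray: a one-way infinite path. -/
structure Ray (G : SimpleGraph V) where
  toFun : ℕ → V
  injective : Function.Injective toFun
  adj : ∀ n, G.Adj (toFun n) (toFun (n + 1))

/-- The ray has a tail in the set `S` of vertices. -/
def Ray.HasTailIn {G : SimpleGraph V} (r : Ray G) (S : Set V) : Prop :=
  ∃ n, ∀ m, n ≤ m → r.toFun m ∈ S

lemma Ray.HasTailIn.inter {G : SimpleGraph V} {r : Ray G} {S T : Set V}
    (hS : r.HasTailIn S) (hT : r.HasTailIn T) : r.HasTailIn (S ∩ T) := by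
  obtain ⟨n, hn⟩ := hS
  obtain ⟨k, hk⟩ := hT
  exact ⟨max n k, fun m hm => ⟨hn m (le_of_max_le_left hm), hk m (le_of_max_le_right hm)⟩⟩

lemma Ray.HasTailIn.mono {G : SimpleGraph V} {r : Ray G} {S T : Set V}
    (hS : r.HasTailIn S) (h : S ⊆ T) : r.HasTailIn T :=
  hS.imp fun _ hn m hm => h (hn m hm)

lemma Ray.HasTailIn.infinite {G : SimpleGraph V} {r : Ray G} {S : Set V}
    (hS : r.HasTailIn S) : S.Infinite := by
  obtain ⟨n, hn⟩ := hS
  refine Set.infinite_of_injective_forall_mem (f := fun k : ℕ => r.toFun (n + k)) ?_ ?_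
  · intro a b hab
    have := r.injective hab
    omega
  · intro k
    exact hn _ (Nat.le_add_right n k)

lemma Ray.hasTailIn_compl {G : SimpleGraph V} (r : Ray G) {S : Set V} (hS : S.Finite) :
    r.HasTailIn Sᶜ := by
  have h : (r.toFun ⁻¹' S).Finite := hS.preimage r.injective.injOn
  obtain ⟨n, hn⟩ := h.bddAbove
  refine ⟨n + 1, fun m hm hmS => ?_⟩
  have := hn (show m ∈ r.toFun ⁻¹' S from hmS)
  omega

lemma Ray.exists_comp {G : SimpleGraph V} (r : Ray G) (X : Finset V) :
    ∃ C : Comp G X, r.HasTailIn C := by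
  obtain ⟨n, hn⟩ := r.hasTailIn_compl X.finite_toSet
  refine ⟨G.componentComplMk (hn n le_rfl), n, fun m hm => ?_⟩
  induction m, hm using Nat.le_induction with
  | base => exact ⟨hn n le_rfl, rfl⟩
  | succ k hk ih =>
    exact SimpleGraph.ComponentCompl.mem_of_adj _ _ ih (hn (k + 1) (by omega)) (r.adj k)

lemma Ray.comp_unique {G : SimpleGraph V} {r : Ray G} {X : Finset V} {C D : Comp G X}
    (hC : r.HasTailIn C) (hD : r.HasTailIn D) : C = D := by
  obtain ⟨v, hv⟩ := (hC.inter hD).infinite.nonempty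
  exact comp_eq_of_mem hv.1 hv.2

/-- Two rays are equivalent if for every finite set `X` of vertices both have a tail in the same
component of `G - X`. -/
def raySetoid (G : SimpleGraph V) : Setoid (Ray G) where
  r r₁ r₂ := ∀ X : Finset V, ∃ C : Comp G X, r₁.HasTailIn C ∧ r₂.HasTailIn C
  iseqv :=
    { refl := fun r X => (r.exists_comp X).imp fun _ h => ⟨h, h⟩
      symm := fun h X => (h X).imp fun _ h => ⟨h.2, h.1⟩
      trans := fun {a b c} h h' X => by
        obtain ⟨C, hC1, hC2⟩ := h X
        obtain ⟨D, hD1, hD2⟩ := h' X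
        obtain rfl := Ray.comp_unique hC2 hD1
        exact ⟨C, hC1, hD2⟩ }

/-- `Ω`, the set of ends of `G`: the equivalence classes of rays. -/
def Ends (G : SimpleGraph V) : Type u := Quotient (raySetoid G)

/-- The end containing a given ray. -/
def Ray.toEnd {G : SimpleGraph V} (r : Ray G) : Ends G := Quotient.mk (raySetoid G) r

lemma Ends.exists_ray {G : SimpleGraph V} (ω : Ends G) : ∃ r : Ray G, r.toEnd = ω :=
  Quotient.exists_rep ω

lemma Ends.exists_comp {G : SimpleGraph V} (ω : Ends G) (X : Finset V) :
    ∃ C : Comp G X, ∀ r : Ray G, r.toEnd = ω → r.HasTailIn C := by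
  obtain ⟨r, rfl⟩ := ω.exists_ray
  obtain ⟨C, hC⟩ := r.exists_comp X
  refine ⟨C, fun s hs => ?_⟩
  obtain ⟨D, hD1, hD2⟩ := (Quotient.exact hs : (raySetoid G) s r) X
  obtain rfl := Ray.comp_unique hC hD2
  exact hD1

/-- `C(X, ω)`: the component of `G - X` in which every ray of `ω` has a tail. -/
def Ends.comp {G : SimpleGraph V} (ω : Ends G) (X : Finset V) : Comp G X :=
  (ω.exists_comp X).choose

lemma Ends.hasTailIn_comp {G : SimpleGraph V} {ω : Ends G} {r : Ray G} (h : r.toEnd = ω)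
    (X : Finset V) : r.HasTailIn (ω.comp X) :=
  (ω.exists_comp X).choose_spec r h

lemma Ends.compMap_comp {G : SimpleGraph V} (ω : Ends G) {X X' : Finset V} (h : X ⊆ X') :
    compMap G h (ω.comp X') = ω.comp X := by
  obtain ⟨r, hr⟩ := ω.exists_ray
  exact Ray.comp_unique ((Ends.hasTailIn_comp hr X').mono (subset_compMap G h _))
    (Ends.hasTailIn_comp hr X)

/-! ### Tangles -/

/-- `(A, B)` is an oriented separation of `G` of finite order. -/
def IsSep (G : SimpleGraph V) (p : Set V × Set V) : Prop :=
  (p.1 ∩ p.2).Finite ∧ p.1 ∪ p.2 = univ ∧ ∀ a ∈ p.1 \ p.2, ∀ b ∈ p.2 \ p.1, ¬ G.Adj a b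

/-- `(A, B) ≤ (C, D)` if `A ⊆ C` and `B ⊇ D`. -/
def SepLE (p q : Set V × Set V) : Prop := p.1 ⊆ q.1 ∧ q.2 ⊆ p.2

/-- `O` is an orientation of the set of all finite order separations of `G`: it consists of oriented
separations and contains precisely one of `(A, B)` and `(B, A)` for each separation `{A, B}`. -/
def IsOrientation (G : SimpleGraph V) (O : Set (Set V × Set V)) : Prop :=
  (∀ p ∈ O, IsSep G p) ∧
    ∀ p, IsSep G p → (p ∈ O ∨ p.swap ∈ O) ∧ (p ∈ O → p.swap ∈ O → p = p.swap)

/-- No two distinct `(B, A)` and `(C, D)` in `O` satisfy `(A, B) < (C, D)`. -/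
def IsConsistent (O : Set (Set V × Set V)) : Prop :=
  ∀ p ∈ O, ∀ q ∈ O, p ≠ q → ¬ (SepLE p.swap q ∧ p.swap ≠ q)

/-- `σ` is a star of finite order separations of `G`: every two distinct `(A, B)` and `(D, C)`
in `σ` satisfy `(A, B) ≤ (C, D)`. -/
def IsStar (G : SimpleGraph V) (σ : Set (Set V × Set V)) : Prop :=
  (∀ p ∈ σ, IsSep G p) ∧ ∀ p ∈ σ, ∀ q ∈ σ, p ≠ q → SepLE p q.swap

/-- The interior of a star: the intersection of all the big sides. -/
def starInterior (σ : Set (Set V × Set V)) : Set V := ⋂ p ∈ σ, p.2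

/-- An `ℵ₀`-tangle of `G`: a consistent orientation of the set of all finite order separations
that includes no finite star of finite interior. -/
def IsTangle (G : SimpleGraph V) (τ : Set (Set V × Set V)) : Prop :=
  IsOrientation G τ ∧ IsConsistent τ ∧
    ∀ σ ⊆ τ, ¬ (IsStar G σ ∧ σ.Finite ∧ (starInterior σ).Finite)

/-- `Θ`, the set of `ℵ₀`-tangles of `G`. -/
def Tangles (G : SimpleGraph V) : Type u := {τ : Set (Set V × Set V) // IsTangle G τ}

/-- `s_{X → 𝒞} = (V \ V[𝒞], X ∪ V[𝒞])`. -/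
def sepToward {G : SimpleGraph V} (X : Finset V) (𝒞 : Set (Comp G X)) : Set V × Set V :=
  ((vertsOf 𝒞)ᶜ, (X : Set V) ∪ vertsOf 𝒞)

/-- `τ_ω`: the set of all finite order separations `(A, B)` with `C(A ∩ B, ω) ⊆ G[B \ A]`. -/
def endTangleSet {G : SimpleGraph V} (ω : Ends G) : Set (Set V × Set V) :=
  {p | IsSep G p ∧ ∃ X : Finset V, (X : Set V) = p.1 ∩ p.2 ∧ (ω.comp X : Set V) ⊆ p.2 \ p.1}

lemma hasTailIn_of_mem_endTangleSet {G : SimpleGraph V} {ω : Ends G} {p : Set V × Set V}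
    (hp : p ∈ endTangleSet ω) {r : Ray G} (hr : r.toEnd = ω) : r.HasTailIn (p.2 \ p.1) := by
  obtain ⟨_, X, _, hX⟩ := hp
  exact (Ends.hasTailIn_comp hr X).mono hX

lemma IsSep.swap {G : SimpleGraph V} {p : Set V × Set V} (hp : IsSep G p) : IsSep G p.swap := by
  obtain ⟨h1, h2, h3⟩ := hp
  refine ⟨?_, ?_, fun a ha b hb hab => h3 b hb a ha hab.symm⟩
  · rw [Prod.fst_swap, Prod.snd_swap, inter_comm]
    exact h1
  · rw [Prod.fst_swap, Prod.snd_swap, union_comm]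
    exact h2

lemma comp_subset_side {G : SimpleGraph V} {p : Set V × Set V} (hp : IsSep G p) {X : Finset V}
    (hX : (X : Set V) = p.1 ∩ p.2) (C : Comp G X) {v : V} (hv : v ∈ C) (hvp : v ∈ p.2 \ p.1) :
    (C : Set V) ⊆ p.2 \ p.1 := by
  refine comp_subset_of_closed C _ hv hvp fun a b _ ha hb hab => ?_
  have hbX : b ∉ (X : Set V) := SimpleGraph.ComponentCompl.notMem_of_mem hb
  rw [hX] at hbX
  have hbu : b ∈ p.1 ∪ p.2 := hp.2.1 ▸ mem_univ b
  by_cases hb2 : b ∈ p.2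
  · exact ⟨hb2, fun h => hbX ⟨h, hb2⟩⟩
  · exact absurd hab.symm (hp.2.2 b ⟨hbu.resolve_right hb2, hb2⟩ a ha)

lemma isTangle_endTangleSet {G : SimpleGraph V} (ω : Ends G) : IsTangle G (endTangleSet ω) := by
  obtain ⟨r, hr⟩ := ω.exists_ray
  refine ⟨⟨fun p hp => hp.1, fun p hp => ⟨?_, ?_⟩⟩, ?_, ?_⟩
  · obtain ⟨X, hX⟩ := hp.1.exists_finset_coe
    obtain ⟨v, hv⟩ := SimpleGraph.ComponentCompl.nonempty (ω.comp X)
    have hvX : v ∉ (X : Set V) := SimpleGraph.ComponentCompl.notMem_of_mem hv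
    rw [hX] at hvX
    have hvu : v ∈ p.1 ∪ p.2 := hp.2.1 ▸ mem_univ v
    by_cases h2 : v ∈ p.2
    · exact Or.inl ⟨hp, X, hX, comp_subset_side hp hX _ hv ⟨h2, fun h => hvX ⟨h, h2⟩⟩⟩
    · have hX' : (X : Set V) = p.swap.1 ∩ p.swap.2 := by
        rw [hX, inter_comm]
        rfl
      exact Or.inr ⟨hp.swap, X, hX',
        comp_subset_side hp.swap hX' _ hv ⟨hvu.resolve_right h2, h2⟩⟩
  · intro h1 h2
    obtain ⟨v, hv⟩ := ((hasTailIn_of_mem_endTangleSet h1 hr).inter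
      (hasTailIn_of_mem_endTangleSet h2 hr)).infinite.nonempty
    exact absurd hv.1.1 hv.2.2
  · rintro p hp q hq _ ⟨hle, _⟩
    obtain ⟨v, hv⟩ := ((hasTailIn_of_mem_endTangleSet hp hr).inter
      (hasTailIn_of_mem_endTangleSet hq hr)).infinite.nonempty
    exact hv.2.2 (hle.1 hv.1.1)
  · rintro σ hσ ⟨_, hfin, hint⟩
    have key : r.HasTailIn (starInterior σ) := by
      choose! n hn using fun p (hp : p ∈ σ) => hasTailIn_of_mem_endTangleSet (hσ hp) hr
      obtain ⟨N, hN⟩ := (hfin.image n).bddAbove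
      refine ⟨N, fun m hm => ?_⟩
      simp only [starInterior, mem_iInter]
      exact fun p hp => (hn p hp m ((hN (mem_image_of_mem n hp)).trans hm)).1
    exact key.infinite hint

/-- The end tangle `τ_ω`, as a map `Ω → Θ`. -/
def endTangle {G : SimpleGraph V} (ω : Ends G) : Tangles G :=
  ⟨endTangleSet ω, isTangle_endTangleSet ω⟩

/-! ### The 1-complex of a graph -/

/-- The points of the 1-complex of `G`: the vertices of `G` and the inner edge points. The inner
points of each edge `e` are parametrized by the open unit interval, where `t → 0` corresponds to
the endvertex `(e : Sym2 V).out.1` of `e` and `t → 1` to its endvertex `(e : Sym2 V).out.2`. -/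
inductive OneComplex (G : SimpleGraph V) : Type u
  | vert (v : V)
  | inner (e : G.edgeSet) (t : Ioo (0 : ℝ) 1)

/-- For an endvertex `v` of the edge `e`, the parameters of the inner points of `e` that lie in the
half open interval `[v, i)` of `e`, where `i` is an inner point of `e`. -/
def halfOpen {G : SimpleGraph V} (v : V) (e : G.edgeSet) (i : Ioo (0 : ℝ) 1) :
    Set (Ioo (0 : ℝ) 1) :=
  {t | (v = (e : Sym2 V).out.1 ∧ t < i) ∨ (v = (e : Sym2 V).out.2 ∧ i < t)}

/-- The topology of the 1-complex: inner edge points have their usual basic open neighbourhoods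
from the open unit interval, and the basic open neighbourhoods of a vertex `v` are the unions
`⋃ [v, i_e)` over all edges `e` at `v`, one for each choice of inner points `i_e` of these
edges. -/
instance (G : SimpleGraph V) : TopologicalSpace (OneComplex G) where
  IsOpen U := (∀ e : G.edgeSet, IsOpen {t | OneComplex.inner e t ∈ U}) ∧
    ∀ v : V, OneComplex.vert v ∈ U → ∀ e : G.edgeSet, v ∈ (e : Sym2 V) →
      ∃ i : Ioo (0 : ℝ) 1, ∀ t ∈ halfOpen v e i, OneComplex.inner e t ∈ U
  isOpen_univ := ⟨fun _ => by simp, fun _ _ _ _ => ⟨⟨1 / 2, by norm_num, by norm_num⟩, by simp⟩⟩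
  isOpen_inter := by
    rintro U W ⟨hU1, hU2⟩ ⟨hW1, hW2⟩
    refine ⟨fun e => (hU1 e).inter (hW1 e), fun v hv e he => ?_⟩
    obtain ⟨i, hi⟩ := hU2 v hv.1 e he
    obtain ⟨j, hj⟩ := hW2 v hv.2 e he
    have hne : (e : Sym2 V).out.1 ≠ (e : Sym2 V).out.2 := by
      intro h
      have hd := G.not_isDiag_of_mem_edgeSet e.2
      rw [← Quot.out_eq (e : Sym2 V)] at hd
      exact hd h
    by_cases hv1 : v = (e : Sym2 V).out.1
    · refine ⟨min i j, fun t ht => ?_⟩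
      rcases ht with ⟨_, ht⟩ | ⟨h2, _⟩
      · exact ⟨hi t (Or.inl ⟨hv1, ht.trans_le (min_le_left _ _)⟩),
          hj t (Or.inl ⟨hv1, ht.trans_le (min_le_right _ _)⟩)⟩
      · exact absurd (hv1.symm.trans h2) hne
    · refine ⟨max i j, fun t ht => ?_⟩
      rcases ht with ⟨h1, _⟩ | ⟨h2, ht⟩
      · exact absurd h1 hv1
      · exact ⟨hi t (Or.inr ⟨h2, (le_max_left _ _).trans_lt ht⟩),
          hj t (Or.inr ⟨h2, (le_max_right _ _).trans_lt ht⟩)⟩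
  isOpen_sUnion := by
    intro S hS
    refine ⟨fun e => ?_, ?_⟩
    · have : {t | OneComplex.inner e t ∈ ⋃₀ S} = ⋃ U ∈ S, {t | OneComplex.inner e t ∈ U} := by
        ext t
        simp
      rw [this]
      exact isOpen_biUnion fun U hU => (hS U hU).1 e
    · rintro v ⟨U, hU, hv⟩ e he
      obtain ⟨i, hi⟩ := (hS U hU).2 v hv e he
      exact ⟨i, fun t ht => ⟨U, hU, hi t ht⟩⟩

/-- `⋃ 𝒞 ∪ E̊(X, ⋃ 𝒞)` as a set of points of the 1-complex, for a set `𝒞` of components of `G - X`: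
the vertices of the components in `𝒞`, the inner points of the edges of these components, and the
inner points of the edges between `X` and these components. -/
def compRegion {G : SimpleGraph V} (X : Finset V) (𝒞 : Set (Comp G X)) : Set (OneComplex G) :=
  {p | (∃ v ∈ vertsOf 𝒞, p = OneComplex.vert v) ∨
    ∃ e t, p = OneComplex.inner e t ∧
      ((∃ C ∈ 𝒞, ∀ v ∈ (e : Sym2 V), v ∈ C) ∨
        ∃ x ∈ X, ∃ v ∈ vertsOf 𝒞, (e : Sym2 V) = s(x, v))}

/-! ### The tangle compactification -/

/-- The point set `G ⊔ Θ` of the tangle compactification `|G|_Θ`. -/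
inductive TangleCompactification (G : SimpleGraph V) : Type u
  | ofGraph (p : OneComplex G)
  | ofTangle (τ : Tangles G)

/-- The open set `𝒪(X, 𝒞)` of `|G|_Θ`; the tangles in it are those whose ultrafilter
`U(τ, X) = {𝒞 | s_{X → 𝒞} ∈ τ}` on the set of components of `G - X` contains `𝒞`. -/
def tangleNhd {G : SimpleGraph V} (X : Finset V) (𝒞 : Set (Comp G X)) :
    Set (TangleCompactification G) :=
  TangleCompactification.ofGraph '' compRegion X 𝒞 ∪
    TangleCompactification.ofTangle '' {τ | sepToward X 𝒞 ∈ τ.1}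

/-- The topology of `|G|_Θ`, generated by the open sets of `G` and the sets `𝒪(X, 𝒞)`. -/
instance (G : SimpleGraph V) : TopologicalSpace (TangleCompactification G) :=
  TopologicalSpace.generateFrom
    ({S | ∃ U : Set (OneComplex G), IsOpen U ∧ S = TangleCompactification.ofGraph '' U} ∪
      {S | ∃ (X : Finset V) (𝒞 : Set (Comp G X)), S = tangleNhd X 𝒞})

/-! ### `𝒞`-systems and the compactifications they induce -/

/-- A `𝒞`-system of `G`: an inverse system of Hausdorff compactifications of the discrete spaces
`𝒞_X`, indexed by the finite sets `X` of vertices, whose bonding maps extend the maps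
`𝔠_{X',X}`. -/
structure CSystem (G : SimpleGraph V) : Type (u + 1) where
  /-- the compactification `α(𝒞_X)` of `𝒞_X` -/
  space : Finset V → Type u
  top : ∀ X, TopologicalSpace (space X)
  compact : ∀ X, CompactSpace (space X)
  t2 : ∀ X, T2Space (space X)
  /-- the embedding `α_X` of the discrete space `𝒞_X` as a dense subset -/
  emb : ∀ X, Comp G X → space X
  isEmbedding_emb : ∀ X, @IsEmbedding _ _ ⊥ (top X) (emb X)
  denseRange_emb : ∀ X, DenseRange (emb X)
  /-- the bonding map `𝔞_{X',X}` -/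
  bond : ∀ {X X' : Finset V}, X ⊆ X' → space X' → space X
  continuous_bond : ∀ {X X' : Finset V} (h : X ⊆ X'), Continuous (bond h)
  bond_refl : ∀ (X : Finset V) (p : space X), bond (Finset.Subset.refl X) p = p
  bond_trans : ∀ {X X' X'' : Finset V} (h : X ⊆ X') (h' : X' ⊆ X'') (p : space X''),
    bond (h.trans h') p = bond h (bond h' p)
  bond_emb : ∀ {X X' : Finset V} (h : X ⊆ X') (C : Comp G X'),
    bond h (emb X' C) = emb X (compMap G h C)

attribute [instance] CSystem.top CSystem.compact CSystem.t2

namespace CSystem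

variable {G : SimpleGraph V}

/-- The inverse limit `ℐ^α` of a `𝒞`-system. -/
def Limit (α : CSystem G) : Type u :=
  {p : ∀ X, α.space X // ∀ (X X' : Finset V) (h : X ⊆ X'), α.bond h (p X') = p X}

/-- The canonical map `ι^α : Ω → ℐ^α`, sending an end `ω` to `(α_X(C(X, ω)))_X`. -/
def endLimit (α : CSystem G) (ω : Ends G) : α.Limit :=
  ⟨fun X => α.emb X (ω.comp X), fun X X' h => by rw [α.bond_emb, ω.compMap_comp]⟩

/-- The point set `αG = G ⊔ ℐ^α`. -/
inductive Extension (α : CSystem G) : Type u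
  | ofGraph (p : OneComplex G)
  | ofLimit (ξ : α.Limit)

/-- The open set `𝒪_{αG}(X, O)` of `αG`. -/
def nhd (α : CSystem G) (X : Finset V) (O : Set (α.space X)) : Set α.Extension :=
  Extension.ofGraph '' compRegion X (α.emb X ⁻¹' O) ∪
    Extension.ofLimit '' {ξ | ξ.1 X ∈ O}

/-- The topology of `αG`, generated by the open sets of `G` and the sets `𝒪_{αG}(X, O)`. -/
instance (α : CSystem G) : TopologicalSpace α.Extension :=
  TopologicalSpace.generateFrom
    ({S | ∃ U : Set (OneComplex G), IsOpen U ∧ S = Extension.ofGraph '' U} ∪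
      {S | ∃ (X : Finset V) (O : Set (α.space X)), IsOpen O ∧ S = α.nhd X O})

/-- `𝒞^α ≤ 𝒞^δ`: there are maps `f_X : (δ(𝒞_X), δ_X) ≥ (α(𝒞_X), α_X)` of compactifications that
are compatible with the bonding maps. -/
def Le (α δ : CSystem G) : Prop :=
  ∃ f : ∀ X, δ.space X → α.space X,
    (∀ X, Continuous (f X) ∧ ∀ C, f X (δ.emb X C) = α.emb X C) ∧
      ∀ (X X' : Finset V) (h : X ⊆ X') (p : δ.space X'),
        f X (δ.bond h p) = α.bond h (f X' p)

/-- `𝒞`-equivalence of `𝒞`-systems. -/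
def Equivalent (α δ : CSystem G) : Prop := Le α δ ∧ Le δ α

end CSystem

/-! ### The `𝒞`-system `𝒞^𝒰` -/

/-- The `𝒞`-system `𝒞^𝒰` formed by the Stone–Čech compactifications of the discrete spaces `𝒞_X`,
that is, by the spaces of ultrafilters on the sets `𝒞_X`. -/
def ultrafilterSystem (G : SimpleGraph V) : CSystem G where
  space X := Ultrafilter (Comp G X)
  top _ := inferInstance
  compact _ := inferInstance
  t2 _ := inferInstance
  emb _ C := pure C
  isEmbedding_emb X := by
    let _ : TopologicalSpace (Comp G X) := ⊥
    exact (isDenseEmbedding_pure (α := Comp G X)).isEmbedding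
  denseRange_emb _ := denseRange_pure
  bond h U := U.map (compMap G h)
  continuous_bond h := by
    refine continuous_generateFrom_iff.2 ?_
    rintro _ ⟨s, rfl⟩
    exact ultrafilter_isOpen_basic (compMap G h ⁻¹' s)
  bond_refl X U := by
    have : compMap G (Finset.Subset.refl X) = id := funext (compMap_refl G)
    rw [this, Ultrafilter.map_id]
  bond_trans h h' U := by
    have : compMap G (h.trans h') = compMap G h ∘ compMap G h' := funext (compMap_trans G h h')
    rw [this, Ultrafilter.map_map]
  bond_emb h C := Ultrafilter.map_pure (compMap G h) C

/-! ### The `𝒞`-system `𝒞^Γ` -/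

/-- `Γ_X = 𝒞_X ⊔ crit(X)`, where `crit(X)` is the set of critical subsets of `X`. -/
inductive GammaSpace (G : SimpleGraph V) (X : Finset V) : Type u
  | comp (C : Comp G X)
  | crit (Y : Finset V) (hY : IsCritical G Y) (hYX : Y ⊆ X)

/-- The topology of `Γ_X`, generated by all sets of components of `G - X` and all sets `𝒞 ⊔ {Y}`
with `Y` a critical subset of `X` and `𝒞` a cofinite subset of `𝒞_X(Y)`. -/
instance (G : SimpleGraph V) (X : Finset V) : TopologicalSpace (GammaSpace G X) :=
  TopologicalSpace.generateFrom
    ({S | ∃ 𝒞 : Set (Comp G X), S = GammaSpace.comp '' 𝒞} ∪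
      {S | ∃ (Y : Finset V) (hY : IsCritical G Y) (hYX : Y ⊆ X) (𝒞 : Set (Comp G X)),
        𝒞 ⊆ compsWithNbhd G X Y ∧ (compsWithNbhd G X Y \ 𝒞).Finite ∧
          S = GammaSpace.comp '' 𝒞 ∪ {GammaSpace.crit Y hY hYX}})

open Classical in
/-- The bonding map `Γ_{X'} → Γ_X`: it coincides with `𝔠_{X',X}` on `𝒞_{X'}`, is the identity on the
critical subsets of `X`, and sends every other critical subset `Y` of `X'` to the component
`C_X(Y)` of `G - X` meeting it. -/
def gammaBond (G : SimpleGraph V) {X X' : Finset V} (h : X ⊆ X') :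
    GammaSpace G X' → GammaSpace G X
  | .comp C => .comp (compMap G h C)
  | .crit Y hY _ => if hYX : Y ⊆ X then .crit Y hY hYX else .comp (compMeeting G hYX)

lemma gamma_isOpen_iff {G : SimpleGraph V} {X : Finset V} {U : Set (GammaSpace G X)} :
    IsOpen U ↔ ∀ (Y : Finset V) (hY : IsCritical G Y) (hYX : Y ⊆ X), GammaSpace.crit Y hY hYX ∈ U →
      {C ∈ compsWithNbhd G X Y | GammaSpace.comp C ∉ U}.Finite := by
  constructor
  · intro hU
    induction hU with
    | basic S hS =>
      intro Y hY hYX hmem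
      rcases hS with ⟨𝒞, rfl⟩ | ⟨Z, hZ, hZX, 𝒞, h1, h2, rfl⟩
      · obtain ⟨C, _, hC⟩ := hmem
        cases hC
      · rcases hmem with ⟨C, _, hC⟩ | hmem
        · cases hC
        · cases hmem
          refine h2.subset ?_
          rintro C ⟨hC1, hC2⟩
          exact ⟨hC1, fun hC => hC2 (Or.inl ⟨C, hC, rfl⟩)⟩
    | univ => intro Y hY hYX _; simp
    | inter S T _ _ ihS ihT =>
      intro Y hY hYX hmem
      refine ((ihS Y hY hYX hmem.1).union (ihT Y hY hYX hmem.2)).subset ?_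
      rintro C ⟨hC1, hC2⟩
      by_cases hCS : GammaSpace.comp C ∈ S
      · exact Or.inr ⟨hC1, fun hCT => hC2 ⟨hCS, hCT⟩⟩
      · exact Or.inl ⟨hC1, hCS⟩
    | sUnion 𝒮 _ ih =>
      rintro Y hY hYX ⟨S, hS, hmem⟩
      refine (ih S hS Y hY hYX hmem).subset ?_
      rintro C ⟨hC1, hC2⟩
      exact ⟨hC1, fun hCS => hC2 ⟨S, hS, hCS⟩⟩
  · intro hU
    rw [isOpen_iff_forall_mem_open]
    rintro (C | ⟨Y, hY, hYX⟩) hmem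
    · refine ⟨GammaSpace.comp '' {C}, ?_, TopologicalSpace.isOpen_generateFrom_of_mem
        (Or.inl ⟨_, rfl⟩), ⟨C, rfl, rfl⟩⟩
      rintro _ ⟨_, rfl, rfl⟩
      exact hmem
    · refine ⟨GammaSpace.comp '' {C ∈ compsWithNbhd G X Y | GammaSpace.comp C ∈ U} ∪
        {GammaSpace.crit Y hY hYX}, ?_, TopologicalSpace.isOpen_generateFrom_of_mem
        (Or.inr ⟨Y, hY, hYX, _, fun C hC => hC.1, ?_, rfl⟩), Or.inr rfl⟩
      · rintro _ (⟨C, hC, rfl⟩ | rfl)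
        · exact hC.2
        · exact hmem
      · refine (hU Y hY hYX hmem).subset ?_
        rintro C ⟨hC1, hC2⟩
        exact ⟨hC1, fun h => hC2 ⟨hC1, h⟩⟩

lemma gamma_isOpen_comp {G : SimpleGraph V} {X : Finset V} (𝒞 : Set (Comp G X)) :
    IsOpen (GammaSpace.comp '' 𝒞) :=
  TopologicalSpace.isOpen_generateFrom_of_mem (Or.inl ⟨𝒞, rfl⟩)

lemma finite_range_crit (G : SimpleGraph V) (X : Finset V) :
    {p : GammaSpace G X | ∃ Y hY hYX, p = GammaSpace.crit Y hY hYX}.Finite := by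
  have : {p : GammaSpace G X | ∃ Y hY hYX, p = GammaSpace.crit Y hY hYX} ⊆
      ⋃ Y ∈ (X.powerset : Set (Finset V)), {p | ∃ hY hYX, p = GammaSpace.crit Y hY hYX} := by
    rintro p ⟨Y, hY, hYX, rfl⟩
    simp only [mem_iUnion]
    exact ⟨Y, by simpa using hYX, hY, hYX, rfl⟩
  refine (X.powerset.finite_toSet.biUnion fun Y _ => ?_).subset this
  refine Set.Subsingleton.finite ?_
  rintro _ ⟨hY, hYX, rfl⟩ _ ⟨_, _, rfl⟩
  rfl

lemma nbhd_subset {G : SimpleGraph V} {X : Finset V} (C : Comp G X) :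
    nbhd G (C : Set V) ⊆ (X : Set V) := by
  rintro v ⟨hvC, c, hc, hcv⟩
  by_contra hvX
  exact hvC (SimpleGraph.ComponentCompl.mem_of_adj _ _ hc hvX hcv)

/-- An open set of `Γ_X` that contains all critical subsets of `X` misses only finitely many
components. -/
lemma gamma_finite_compl {G : SimpleGraph V} {X : Finset V} {U : Set (GammaSpace G X)}
    (hU : IsOpen U) (h : ∀ Y hY hYX, GammaSpace.crit Y hY hYX ∈ U) : (Uᶜ).Finite := by
  have : Uᶜ ⊆ ⋃ Y ∈ (X.powerset : Set (Finset V)),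
      GammaSpace.comp '' {C ∈ compsWithNbhd G X Y | GammaSpace.comp C ∉ U} := by
    rintro (C | ⟨Y, hY, hYX⟩) hp
    · have hfin : (nbhd G (C : Set V)).Finite := X.finite_toSet.subset (nbhd_subset C)
      obtain ⟨Y, hY⟩ := hfin.exists_finset_coe
      simp only [mem_iUnion]
      refine ⟨Y, ?_, C, ⟨hY.symm, hp⟩, rfl⟩
      have := nbhd_subset C
      rw [← hY] at this
      simpa using this
    · exact absurd (h Y hY hYX) hp
  refine (X.powerset.finite_toSet.biUnion fun Y hY => Set.Finite.image _ ?_).subset this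
  have hYX : Y ⊆ X := by simpa using hY
  by_cases hcrit : IsCritical G Y
  · exact gamma_isOpen_iff.1 hU Y hcrit hYX (h Y hcrit hYX)
  · have hfin : (compsWithNbhd G X Y).Finite := by
      by_contra hinf
      exact hcrit ((compsWithNbhd_infinite_iff hYX).1 hinf)
    exact hfin.subset fun C hC => hC.1

lemma gamma_compactSpace (G : SimpleGraph V) (X : Finset V) : CompactSpace (GammaSpace G X) := by
  refine ⟨isCompact_of_finite_subcover fun {ι} U hUo hU => ?_⟩
  obtain ⟨t, ht⟩ := (finite_range_crit G X).isCompact.elim_finite_subcover U hUo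
    fun p _ => hU (mem_univ p)
  have hfin : ((⋃ i ∈ t, U i)ᶜ).Finite :=
    gamma_finite_compl (isOpen_biUnion fun i _ => hUo i) fun Y hY hYX => ht ⟨Y, hY, hYX, rfl⟩
  obtain ⟨t', ht'⟩ := hfin.isCompact.elim_finite_subcover U hUo fun p _ => hU (mem_univ p)
  classical
  refine ⟨t ∪ t', fun p _ => ?_⟩
  by_cases hp : p ∈ ⋃ i ∈ t, U i
  · simp only [mem_iUnion] at hp ⊢
    obtain ⟨i, hi, hpi⟩ := hp
    exact ⟨i, Finset.mem_union_left _ hi, hpi⟩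
  · have := ht' hp
    simp only [mem_iUnion] at this ⊢
    obtain ⟨i, hi, hpi⟩ := this
    exact ⟨i, Finset.mem_union_right _ hi, hpi⟩

/-- The open neighbourhood `𝒞_X(Y) ⊔ {Y}` of `Y`, with finitely many components removed. -/
lemma gamma_isOpen_crit {G : SimpleGraph V} {X Y : Finset V} (hY : IsCritical G Y) (hYX : Y ⊆ X)
    {F : Set (Comp G X)} (hF : F.Finite) :
    IsOpen (GammaSpace.comp '' (compsWithNbhd G X Y \ F) ∪ {GammaSpace.crit Y hY hYX}) :=
  TopologicalSpace.isOpen_generateFrom_of_mem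
    (Or.inr ⟨Y, hY, hYX, _, sdiff_subset, hF.subset (by simp), rfl⟩)

lemma gamma_t2Space (G : SimpleGraph V) (X : Finset V) : T2Space (GammaSpace G X) := by
  have key : ∀ (C : Comp G X) (Y : Finset V) (hY : IsCritical G Y) (hYX : Y ⊆ X),
      ∃ U W : Set (GammaSpace G X), IsOpen U ∧ IsOpen W ∧ GammaSpace.comp C ∈ U ∧
        GammaSpace.crit Y hY hYX ∈ W ∧ Disjoint U W := by
    intro C Y hY hYX
    refine ⟨_, _, gamma_isOpen_comp {C}, gamma_isOpen_crit hY hYX (finite_singleton C),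
      ⟨C, rfl, rfl⟩, Or.inr rfl, ?_⟩
    rw [Set.disjoint_left]
    rintro _ ⟨_, rfl, rfl⟩ (⟨D, hD, hDC⟩ | h)
    · cases hDC
      exact hD.2 rfl
    · cases h
  refine ⟨?_⟩
  rintro (C | ⟨Y, hY, hYX⟩) (D | ⟨Z, hZ, hZX⟩) hne
  · refine ⟨_, _, gamma_isOpen_comp {C}, gamma_isOpen_comp {D}, ⟨C, rfl, rfl⟩, ⟨D, rfl, rfl⟩, ?_⟩
    rw [Set.disjoint_left]
    rintro _ ⟨_, rfl, rfl⟩ ⟨_, rfl, h⟩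
    exact hne h.symm
  · exact key C Z hZ hZX
  · obtain ⟨U, W, hU, hW, h1, h2, h3⟩ := key D Y hY hYX
    exact ⟨W, U, hW, hU, h2, h1, h3.symm⟩
  · refine ⟨_, _, gamma_isOpen_crit hY hYX finite_empty, gamma_isOpen_crit hZ hZX finite_empty,
      Or.inr rfl, Or.inr rfl, ?_⟩
    rw [Set.disjoint_left]
    rintro _ (⟨C, hC, rfl⟩ | rfl) h
    · rcases h with ⟨D, hD, hDC⟩ | h
      · cases hDC
        have hYZ : (Y : Set V) = Z := Eq.trans (Eq.symm hC.1) hD.1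
        have hYZ' : Y = Z := Finset.coe_injective hYZ
        subst hYZ'
        exact hne rfl
      · cases h
    · rcases h with ⟨D, hD, hDC⟩ | h
      · cases hDC
      · exact hne h

lemma gamma_isEmbedding (G : SimpleGraph V) (X : Finset V) :
    @IsEmbedding _ _ ⊥ _ (GammaSpace.comp (G := G) (X := X)) := by
  let _ : TopologicalSpace (Comp G X) := ⊥
  have _ : DiscreteTopology (Comp G X) := ⟨rfl⟩
  have hinj : Function.Injective (GammaSpace.comp (G := G) (X := X)) := by
    intro C D h
    cases h
    rfl
  exact (IsOpenEmbedding.of_continuous_injective_isOpenMap continuous_of_discreteTopology hinj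
    fun 𝒞 _ => gamma_isOpen_comp 𝒞).isEmbedding

lemma gamma_denseRange (G : SimpleGraph V) (X : Finset V) :
    DenseRange (GammaSpace.comp (G := G) (X := X)) := by
  rw [DenseRange, dense_iff_inter_open]
  rintro U hU ⟨C | ⟨Y, hY, hYX⟩, hp⟩
  · exact ⟨_, hp, C, rfl⟩
  · have hfin := gamma_isOpen_iff.1 hU Y hY hYX hp
    obtain ⟨C, hC, hC'⟩ := (((compsWithNbhd_infinite_iff hYX).2 hY).sdiff hfin).nonempty
    refine ⟨GammaSpace.comp C, ?_, C, rfl⟩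
    by_contra h
    exact hC' ⟨hC, h⟩

lemma gamma_continuous_bond (G : SimpleGraph V) {X X' : Finset V} (h : X ⊆ X') :
    Continuous (gammaBond G h) := by
  refine ⟨fun U hU => gamma_isOpen_iff.2 fun Y hY hYX' hmem => ?_⟩
  by_cases hYX : Y ⊆ X
  · have hmem' : GammaSpace.crit Y hY hYX ∈ U := by
      simpa [gammaBond, hYX] using hmem
    have hfin := gamma_isOpen_iff.1 hU Y hY hYX hmem'
    refine Set.Finite.of_finite_image (f := compMap G h) (hfin.subset ?_)
      ((compMap_injOn h hYX).mono fun C hC => hC.1)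
    rintro _ ⟨C, ⟨hC1, hC2⟩, rfl⟩
    exact ⟨compMap_mem_compsWithNbhd h hYX hC1, hC2⟩
  · have hmem' : GammaSpace.comp (compMeeting G hYX) ∈ U := by
      simpa [gammaBond, hYX] using hmem
    convert finite_empty (α := Comp G X')
    rw [Set.eq_empty_iff_forall_notMem]
    rintro C ⟨hC1, hC2⟩
    obtain ⟨y, hyY, hyX⟩ := Finset.not_subset.1 hYX
    have hy : y ∈ nbhd G (C : Set V) := by
      rw [show nbhd G (C : Set V) = (Y : Set V) from hC1]
      exact hyY
    obtain ⟨_, c, hc, hcy⟩ := hy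
    have hyC : y ∈ compMap G h C :=
      SimpleGraph.ComponentCompl.mem_of_adj _ _ (subset_compMap G h C hc) hyX hcy
    refine hC2 ?_
    change GammaSpace.comp (compMap G h C) ∈ U
    rwa [← compMeeting_eq hYX hY hyY hyC]

/-- The `𝒞`-system `𝒞^Γ` formed by the spaces `Γ_X`. -/
def gammaSystem (G : SimpleGraph V) : CSystem G where
  space X := GammaSpace G X
  top _ := inferInstance
  compact X := gamma_compactSpace G X
  t2 X := gamma_t2Space G X
  emb _ C := GammaSpace.comp C
  isEmbedding_emb X := gamma_isEmbedding G X
  denseRange_emb X := gamma_denseRange G X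
  bond h := gammaBond G h
  continuous_bond h := gamma_continuous_bond G h
  bond_refl X p := by
    rcases p with C | ⟨Y, hY, hYX⟩
    · simp only [gammaBond, compMap_refl]
    · simp [gammaBond, hYX]
  bond_trans {X X' X''} h h' p := by
    rcases p with C | ⟨Y, hY, hYX''⟩
    · simp only [gammaBond, compMap_trans G h h']
    · by_cases hYX' : Y ⊆ X'
      · by_cases hYX : Y ⊆ X <;> simp [gammaBond, hYX, hYX']
      · have hYX : ¬ Y ⊆ X := fun hs => hYX' (hs.trans h)
        obtain ⟨y, hyY, hy⟩ := exists_mem_compMeeting G hYX'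
        simp [gammaBond, hYX, hYX', compMeeting_eq hYX hY hyY (subset_compMap G h _ hy)]
  bond_emb _ _ := rfl

/-! ### Equivalence of compactifications -/

/-- Two compactifications `(K, h)` and `(K', h')` of the same space `P` are topologically equivalent
if there is a homeomorphism `f : K' → K` with `f ∘ h' = h`. -/
def TopEquivalent {P K K' : Type*} [TopologicalSpace K] [TopologicalSpace K']
    (h : P → K) (h' : P → K') : Prop :=
  ∃ f : K' ≃ₜ K, ∀ x, f (h' x) = h x

/-- The point set `G ⊔ Ω` of `|G|_Ω`. -/
inductive EndExtension (G : SimpleGraph V) : Type u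
  | ofGraph (p : OneComplex G)
  | ofEnd (ω : Ends G)

/-- The canonical inclusion of `G ⊔ Ω` in `αG = G ⊔ ℐ^α`. -/
def CSystem.ofEndExtension {G : SimpleGraph V} (α : CSystem G) : EndExtension G → α.Extension
  | .ofGraph p => .ofGraph p
  | .ofEnd ω => .ofLimit (α.endLimit ω)

/-- The canonical inclusion of `G ⊔ Ω` in `|G|_Θ = G ⊔ Θ`. -/
def tangleOfEndExtension {G : SimpleGraph V} : EndExtension G → TangleCompactification G
  | .ofGraph p => .ofGraph p
  | .ofEnd ω => .ofTangle (endTangle ω)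

end EndsTangles

end

namespace EndsTangles

/-! Toughness is the hub: each of the other conditions is proved equivalent to it.

In a tough graph every `Comp G X` is finite, so it admits only one Hausdorff compactification,
itself. A point of the inverse limit of any system is then a direction: a compatible choice of one
component of `G - X` for every finite `X`. A tangle is also a direction, because it must point to
exactly one of finitely many components (`IsTangle.exists_sepToward_singleton_mem`), compatibly so
because it is closed under suprema (`IsTangle.sup_mem`). The main graph-theoretic input is that
every direction is defined by an end (`IsDirection.exists_end`). Hence the limits and the set of
tangles all coincide with the set of ends, and the two topologies agree.

If the graph is not tough, the pigeonhole principle gives a critical set `Y` (`exists_critical`). In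
`Γ` it defines a point that is no end and whose neighbourhoods contain almost all components with
neighbourhood `Y`. Ultrafilters and tangles are finer: for every set `A` of components they choose
`A` or its complement. Taking `A` to split those components into two infinite parts rules out a map
from `Γ_Y` to the ultrafilters as well as a homeomorphism. Finally, a free ultrafilter on infinitely
many components induces a tangle that is no end tangle. -/

variable {V : Type u} {G : SimpleGraph V}

/-! ### Infinite walks and rays -/

/-- Every infinite walk that visits each vertex only finitely often includes a ray. -/
lemma exists_ray_of_walk (w : ℕ → V) (hadj : ∀ n, G.Adj (w n) (w (n + 1)))
    (hfin : ∀ v, ∃ n, ∀ m, n ≤ m → w m ≠ v) :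
    ∃ (r : Ray G) (k : ℕ → ℕ), StrictMono k ∧ ∀ n, r.toFun n = w (k n) := by
  classical
  have hlast : ∀ n, ∃ m, n ≤ m ∧ w m = w n ∧ ∀ l, m < l → w l ≠ w m := by
    intro n
    obtain ⟨N, hN⟩ := hfin (w n)
    let S : Finset ℕ := (Finset.range N).filter fun m => w m = w n
    have hnS : n ∈ S := by
      simp only [S, Finset.mem_filter, Finset.mem_range, and_true]
      by_contra h
      exact hN n (by omega) rfl
    have hmax := S.max'_mem ⟨n, hnS⟩
    refine ⟨S.max' ⟨n, hnS⟩, S.le_max' n hnS, (Finset.mem_filter.1 hmax).2, fun l hl hwl => ?_⟩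
    rw [(Finset.mem_filter.1 hmax).2] at hwl
    have hlS : l ∈ S := by
      simp only [S, Finset.mem_filter, Finset.mem_range, hwl, and_true]
      by_contra h
      exact hN l (by omega) hwl
    exact absurd (S.le_max' l hlS) (not_le.2 hl)
  choose last hle heq hne using hlast
  -- Loop erasure: stay at a vertex until its last visit, then take one more step and jump to the
  -- last visit of the new vertex. No vertex `w (k n)` recurs after time `k n`, and `w (k (n + 1)) =
  -- w (k n + 1)` is a neighbour of `w (k n)`.
  let k : ℕ → ℕ := fun n => Nat.rec (last 0) (fun _ i => last (i + 1)) n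
  have hk : ∀ n, k (n + 1) = last (k n + 1) := fun _ => rfl
  have hmono : StrictMono k := strictMono_nat_of_lt_succ fun n => by
    rw [hk]
    exact hle (k n + 1)
  have hkne : ∀ n l, k n < l → w l ≠ w (k n) := by
    rintro (_ | n)
    · exact hne 0
    · rw [hk]
      exact hne _
  refine ⟨⟨fun n => w (k n), ?_, fun n => ?_⟩, k, hmono, fun _ => rfl⟩
  · intro a b hab
    rcases lt_trichotomy a b with h | h | h
    · exact absurd hab.symm (hkne a _ (hmono h))
    · exact h
    · exact absurd hab (hkne b _ (hmono h))
  · rw [hk, heq]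
    exact hadj _

/-- Infinitely many walks, each starting where the previous one ends, form an infinite walk. -/
lemma exists_infinite_walk (u : ℕ → V) (hu : ∀ n, u n ≠ u (n + 1))
    (P : ∀ n, G.Walk (u n) (u (n + 1))) :
    ∃ w : ℕ → V, (∀ n, G.Adj (w n) (w (n + 1))) ∧
      ∀ N, ∃ M, ∀ m, M ≤ m → ∃ n, N ≤ n ∧ w m ∈ (P n).support := by
  have hpos : ∀ n, 0 < (P n).length := fun n => by
    by_contra h
    exact hu n (SimpleGraph.Walk.eq_of_length_eq_zero (p := P n) (by omega))
  -- The state `(n, i)` stands for vertex number `i` of `P n`. The last vertex of `P n` is skipped,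
  -- since it is the first vertex of `P (n + 1)`.
  let step : ℕ × ℕ → ℕ × ℕ := fun s =>
    if s.2 + 1 < (P s.1).length then (s.1, s.2 + 1) else (s.1 + 1, 0)
  let s : ℕ → ℕ × ℕ := fun n => step^[n] (0, 0)
  have hs : ∀ n, s (n + 1) = step (s n) := fun n => Function.iterate_succ_apply' step n _
  have hlt : ∀ n, (s n).2 < (P (s n).1).length := by
    intro n
    induction n with
    | zero => exact hpos 0
    | succ n ih =>
      rw [hs]
      by_cases h : (s n).2 + 1 < (P (s n).1).length
      · rw [show step (s n) = ((s n).1, (s n).2 + 1) from if_pos h]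
        exact h
      · rw [show step (s n) = ((s n).1 + 1, 0) from if_neg h]
        exact hpos _
  have hmono : Monotone fun n => (s n).1 := monotone_nat_of_le_succ fun n => by
    simp only [hs, step]
    split_ifs <;> simp
  have hunb : ∀ N, ∃ M, N ≤ (s M).1 := by
    intro N
    induction N with
    | zero => exact ⟨0, Nat.zero_le _⟩
    | succ N ih =>
      obtain ⟨M, hM⟩ := ih
      -- If the first coordinate were stuck at `N`, the second would grow past the length of `P N`.
      by_contra! hcon
      have hN : ∀ j, (s (M + j)).1 = N := fun j =>
        le_antisymm (Nat.lt_succ_iff.1 (hcon _)) (hM.trans (hmono (Nat.le_add_right M j)))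
      have hj : ∀ j, j ≤ (s (M + j)).2 := by
        intro j
        induction j with
        | zero => exact Nat.zero_le _
        | succ j ih =>
          have h1 := hN (j + 1)
          rw [← Nat.add_assoc, hs] at h1 ⊢
          by_cases h : (s (M + j)).2 + 1 < (P (s (M + j)).1).length
          · simp only [step, if_pos h]
            omega
          · simp only [step, if_neg h] at h1
            have := hN j
            omega
      have h1 := hlt (M + (P N).length)
      rw [hN] at h1
      exact absurd (hj (P N).length) (not_le.2 h1)
  refine ⟨fun n => (P (s n).1).getVert (s n).2, fun n => ?_, fun N => ?_⟩
  · have h2 := (P (s n).1).adj_getVert_succ (hlt n)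
    change G.Adj _ ((P (s (n + 1)).1).getVert (s (n + 1)).2)
    rw [hs]
    by_cases h : (s n).2 + 1 < (P (s n).1).length
    · rw [show step (s n) = ((s n).1, (s n).2 + 1) from if_pos h]
      exact h2
    · rw [show step (s n) = ((s n).1 + 1, 0) from if_neg h]
      have hl : (s n).2 + 1 = (P (s n).1).length := le_antisymm (hlt n) (not_lt.1 h)
      rw [hl, SimpleGraph.Walk.getVert_length] at h2
      rw [SimpleGraph.Walk.getVert_zero]
      exact h2
  · obtain ⟨M, hM⟩ := hunb N
    exact ⟨M, fun m hm => ⟨(s m).1, hM.trans (hmono hm),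
      SimpleGraph.Walk.getVert_mem_support _ _⟩⟩

/-- Two vertices of a component are joined by a walk inside it. -/
lemma exists_walk_in_comp {X : Finset V} (C : Comp G X) {a b : V} (ha : a ∈ C) (hb : b ∈ C) :
    ∃ p : G.Walk a b, ∀ v ∈ p.support, v ∈ C := by
  refine comp_subset_of_closed C {b | ∃ p : G.Walk a b, ∀ v ∈ p.support, v ∈ C} ha
    ⟨SimpleGraph.Walk.nil, by simpa using ha⟩ ?_ hb
  rintro c d _ ⟨p, hp⟩ hd hcd
  refine ⟨p.concat hcd, fun v hv => ?_⟩
  rw [SimpleGraph.Walk.support_concat, List.mem_append] at hv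
  rcases hv with hv | hv
  · exact hp v hv
  · rw [List.mem_singleton.1 hv]
    exact hd

/-- A walk avoiding `X` that meets a component of `G - X` stays in that component. -/
lemma walk_subset_comp {X : Finset V} (C : Comp G X) {a b : V} (p : G.Walk a b)
    (hp : ∀ v ∈ p.support, v ∉ X) (ha : a ∈ C) : ∀ v ∈ p.support, v ∈ C := by
  induction p with
  | nil => simpa using ha
  | cons h p ih =>
    simp only [SimpleGraph.Walk.support_cons, List.mem_cons, forall_eq_or_imp] at hp ⊢
    exact ⟨ha, ih hp.2 (SimpleGraph.ComponentCompl.mem_of_adj _ _ ha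
      (hp.2 _ p.start_mem_support) h)⟩

/-! ### Directions and ends -/

/-- A direction of `G`: a choice of a component of `G - X` for every finite `X`, compatible with
inclusion. -/
def IsDirection (f : ∀ X : Finset V, Comp G X) : Prop :=
  ∀ (X X' : Finset V) (h : X ⊆ X'), compMap G h (f X') = f X

namespace IsDirection

variable {f : ∀ X : Finset V, Comp G X}

lemma subset (hf : IsDirection f) {X X' : Finset V} (h : X ⊆ X') : (f X' : Set V) ⊆ f X := by
  rw [← hf X X' h]
  exact subset_compMap G h _

/-- Being connected, `f Y` lies in a single component of `G - X`. That component is `f X`, since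
both contain `f (X ∪ Y)`. No inclusion between `X` and `Y` is needed. -/
lemma subset_of_avoids (hf : IsDirection f) {X Y : Finset V} (h : ∀ x ∈ X, x ∉ f Y) :
    (f Y : Set V) ⊆ f X := by
  classical
  obtain ⟨C, hC⟩ := exists_comp_of_avoids (f Y) h
  obtain ⟨v, hv⟩ := SimpleGraph.ComponentCompl.nonempty (f (X ∪ Y))
  rwa [comp_eq_of_mem (hf.subset Finset.subset_union_left hv)
    (hC (hf.subset Finset.subset_union_right hv))]

/-- If consecutive walks eventually lie in every component chosen by a direction, this direction
is defined by an end. -/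
lemma exists_end_of_walks (u : ℕ → V) (hu : ∀ n, u n ≠ u (n + 1))
    (P : ∀ n, G.Walk (u n) (u (n + 1)))
    (hP : ∀ X, ∃ N, ∀ n, N ≤ n → ∀ v ∈ (P n).support, v ∈ f X) :
    ∃ ω : Ends G, ∀ X, ω.comp X = f X := by
  obtain ⟨w, hadj, hw⟩ := exists_infinite_walk u hu P
  have hev : ∀ X, ∃ M, ∀ m, M ≤ m → w m ∈ f X := by
    intro X
    obtain ⟨N, hN⟩ := hP X
    obtain ⟨M, hM⟩ := hw N
    refine ⟨M, fun m hm => ?_⟩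
    obtain ⟨n, hn, hmem⟩ := hM m hm
    exact hN n hn _ hmem
  -- Since `f {v}` avoids `v`, the walk visits `v` only finitely often.
  obtain ⟨r, k, hk, hr⟩ := exists_ray_of_walk w hadj fun v => by
    obtain ⟨M, hM⟩ := hev {v}
    refine ⟨M, fun m hm hv => ?_⟩
    exact SimpleGraph.ComponentCompl.notMem_of_mem (hM m hm) (by simp [hv])
  refine ⟨r.toEnd, fun X => ?_⟩
  obtain ⟨M, hM⟩ := hev X
  refine Ray.comp_unique (Ends.hasTailIn_comp rfl X) ⟨M, fun m hm => ?_⟩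
  rw [hr]
  exact hM _ (hm.trans (hk.id_le m))

/-- The vertices dominating a direction. -/
def dominating (f : ∀ X : Finset V, Comp G X) : Set V :=
  {x | ∀ X : Finset V, x ∈ X → x ∈ nbhd G (f X : Set V)}

lemma dominating_mem (hf : IsDirection f) {X : Finset V} {x : V} (hx : x ∈ dominating f)
    (hxX : x ∉ X) : x ∈ f X := by
  classical
  obtain ⟨_, c, hc, hcx⟩ := hx (insert x X) (Finset.mem_insert_self x X)
  exact SimpleGraph.ComponentCompl.mem_of_adj _ _ (hf.subset (Finset.subset_insert x X) hc) hxX hcx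

/-- Both vertices have neighbours in the component chosen for `X ∪ {x, y}`, and these neighbours can
be joined inside it. -/
lemma exists_walk_of_dominating {x y : V} (hx : x ∈ dominating f) (hy : y ∈ dominating f)
    (X : Finset V) : ∃ p : G.Walk x y, ∀ v ∈ p.support, v = x ∨ v = y ∨ v ∉ X := by
  classical
  obtain ⟨_, c, hc, hcx⟩ := hx (insert x (insert y X)) (by simp)
  obtain ⟨_, d, hd, hdy⟩ := hy (insert x (insert y X)) (by simp)
  obtain ⟨p, hp⟩ := exists_walk_in_comp _ hc hd
  refine ⟨SimpleGraph.Walk.cons hcx.symm (p.concat hdy), fun v hv => ?_⟩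
  rw [SimpleGraph.Walk.support_cons, SimpleGraph.Walk.support_concat, List.mem_cons, List.mem_append, List.mem_singleton] at hv
  rcases hv with hv | hv | hv
  · exact Or.inl hv
  · have := SimpleGraph.ComponentCompl.notMem_of_mem (hp v hv)
    simp only [Finset.coe_insert, mem_insert_iff, Finset.mem_coe, not_or] at this
    exact Or.inr (Or.inr this.2.2)
  · exact Or.inr (Or.inl hv)

/-- Distinct dominating vertices are joined consecutively by walks whose inner vertices avoid all
earlier walks. Each vertex then lies on finitely many walks, so late walks avoid a given `X`. Such a
walk starts at a dominating vertex outside `X`, which lies in `f X`, and so the walk stays there. -/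
lemma exists_end_of_infinite_dominating (hf : IsDirection f) (hinf : (dominating f).Infinite) :
    ∃ ω : Ends G, ∀ X, ω.comp X = f X := by
  classical
  let u : ℕ → V := fun n => (hinf.natEmbedding _ n : V)
  have hu : Function.Injective u := fun a b h =>
    (hinf.natEmbedding _).injective (Subtype.ext h)
  have hud : ∀ n, u n ∈ dominating f := fun n => (hinf.natEmbedding _ n).2
  choose p hp using fun (n : ℕ) (X : Finset V) =>
    exists_walk_of_dominating (hud n) (hud (n + 1)) X
  -- `Y n` collects all vertices of the first `n` walks.
  let Y : ℕ → Finset V := fun n => Nat.rec ∅ (fun n X => X ∪ (p n X).support.toFinset) n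
  have hY : ∀ n, Y (n + 1) = Y n ∪ (p n (Y n)).support.toFinset := fun _ => rfl
  have hYmono : Monotone Y := monotone_nat_of_le_succ fun n => by
    rw [hY]
    exact Finset.subset_union_left
  have hvert : ∀ x, ∃ N, ∀ n, N ≤ n → x ∉ (p n (Y n)).support := by
    intro x
    have hux : ∃ N, ∀ n, N ≤ n → x ≠ u n := by
      by_cases h : ∃ m, x = u m
      · obtain ⟨m, rfl⟩ := h
        exact ⟨m + 1, fun n hn h => absurd (hu h) (by omega)⟩
      · exact ⟨0, fun n _ hn => h ⟨n, hn⟩⟩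
    obtain ⟨N, hN⟩ := hux
    by_cases h : ∃ n, x ∈ (p n (Y n)).support
    · obtain ⟨m, hm⟩ := h
      have hmY : x ∈ Y (m + 1) := by
        rw [hY]
        exact Finset.mem_union_right _ (List.mem_toFinset.2 hm)
      refine ⟨max N (m + 1), fun n hn hx => ?_⟩
      rcases hp n (Y n) x hx with h | h | h
      · exact hN n (le_of_max_le_left hn) h
      · exact hN (n + 1) ((le_of_max_le_left hn).trans (Nat.le_succ n)) h
      · exact h (hYmono (le_of_max_le_right hn) hmY)
    · exact ⟨0, fun n _ hn => h ⟨n, hn⟩⟩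
  refine exists_end_of_walks u (fun n h => absurd (hu h) (by omega)) (fun n => p n (Y n))
    fun X => ?_
  choose N hN using hvert
  refine ⟨X.sup N, fun n hn => ?_⟩
  have havoid : ∀ v ∈ (p n (Y n)).support, v ∉ X := fun v hv hvX =>
    hN v n ((Finset.le_sup hvX).trans hn) hv
  exact walk_subset_comp _ _ havoid
    (hf.dominating_mem (hud n) (havoid _ (SimpleGraph.Walk.start_mem_support _)))

/-- Every finite `X` extends to a finite `X'` such that all neighbours in `X` of the component
chosen for `X'` dominate the direction. -/
lemma exists_extension (hf : IsDirection f) (X : Finset V) : ∃ X' : Finset V, X ⊆ X' ∧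
    ∀ x ∈ X, x ∈ nbhd G (f X' : Set V) → x ∈ dominating f := by
  classical
  -- A vertex `x` that does not dominate has a witness `Z` containing `x` with `x` not in the
  -- neighbourhood of `f Z`. The witness persists for supersets `X'` of `Z`, because `f X' ⊆ f Z`
  -- and `x ∉ f Z`.
  have h : ∀ x, ∃ Z : Finset V, x ∈ Z ∧ (x ∈ nbhd G (f Z : Set V) → x ∈ dominating f) := by
    intro x
    by_cases hx : x ∈ dominating f
    · exact ⟨{x}, by simp, fun _ => hx⟩
    · simp only [dominating, mem_ofPred_eq, not_forall] at hx
      obtain ⟨Z, hZ, hxZ⟩ := hx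
      exact ⟨Z, hZ, fun h => absurd h hxZ⟩
  choose Z hZ hZd using h
  refine ⟨X ∪ X.biUnion Z, Finset.subset_union_left, fun x hx hxn => hZd x ?_⟩
  have hsub : Z x ⊆ X ∪ X.biUnion Z :=
    (Finset.subset_biUnion_of_mem Z hx).trans Finset.subset_union_right
  obtain ⟨_, c, hc, hcx⟩ := hxn
  exact ⟨fun h => SimpleGraph.ComponentCompl.notMem_of_mem h (hZ x), c, hf.subset hsub hc, hcx⟩

/-- Starting from the set `D` of dominating vertices, the sets `X n` grow so that each absorbs a
vertex of the previous component and, by `exists_extension`, only dominating vertices of `X n` stay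
attached to `f (X (n + 1))`. The components `f (X n)` then shrink to the empty set, and walks
joining their chosen vertices yield the end. -/
lemma exists_end_of_finite_dominating (hf : IsDirection f) (hfin : (dominating f).Finite) :
    ∃ ω : Ends G, ∀ X, ω.comp X = f X := by
  classical
  obtain ⟨D, hD⟩ := hfin.exists_finset_coe
  choose φ hφ hφd using hf.exists_extension
  choose pt hpt using fun X => SimpleGraph.ComponentCompl.nonempty (f X)
  let X : ℕ → Finset V := fun n => Nat.rec D (fun _ Z => φ (insert (pt Z) Z)) n
  have hX : ∀ n, X (n + 1) = φ (insert (pt (X n)) (X n)) := fun _ => rfl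
  have hsucc : ∀ n, insert (pt (X n)) (X n) ⊆ X (n + 1) := fun n => by
    rw [hX]
    exact hφ _
  have hXmono : Monotone X := monotone_nat_of_le_succ fun n =>
    (Finset.subset_insert _ _).trans (hsucc n)
  have hptmem : ∀ n, pt (X n) ∈ X (n + 1) := fun n => hsucc n (Finset.mem_insert_self _ _)
  -- Membership in all `f (X n)` propagates backwards along walks without dominating vertices. If
  -- `b` is in all of them but its neighbour `a` is not in `f (X m)`, then `a` lies in `X m` and is
  -- still attached to `f (X (m + 1))`, hence dominates.
  have hwalk : ∀ {a x : V} (q : G.Walk a x), (∀ v ∈ q.support, v ∉ dominating f) →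
      (∀ n, x ∈ f (X n)) → ∀ m, a ∈ f (X m) := by
    intro a x q
    induction q with
    | nil => exact fun _ h => h
    | cons hadj q ih =>
      rename_i a b c
      intro hq hc m
      simp only [SimpleGraph.Walk.support_cons, List.mem_cons, forall_eq_or_imp] at hq
      by_contra ham
      have haX : a ∈ X m := nbhd_subset _ ⟨ham, b, ih hq.2 hc m, hadj.symm⟩
      have ham' : a ∉ f (X (m + 1)) := fun h =>
        ham (hf.subset (hXmono (Nat.le_succ m)) h)
      refine hq.1 (hφd (insert (pt (X m)) (X m)) a (Finset.mem_insert_of_mem haX) ?_)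
      rw [← hX]
      exact ⟨ham', b, ih hq.2 hc (m + 1), hadj.symm⟩
  have hempty : ∀ x, ∃ n, x ∉ f (X n) := by
    intro x
    by_contra! hx
    -- This walk avoids `X 0 = D`. So `pt (X 0)` would lie in `f (X 1)`, although it was put into `X
    -- 1`.
    obtain ⟨q, hq⟩ := exists_walk_in_comp _ (hpt (X 0)) (hx 0)
    refine SimpleGraph.ComponentCompl.notMem_of_mem (hwalk q (fun v hv hvd => ?_) hx 1) (hptmem 0)
    rw [← hD] at hvd
    exact SimpleGraph.ComponentCompl.notMem_of_mem (hq v hv) hvd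
  have hpt' : ∀ n, pt (X (n + 1)) ∈ f (X n) := fun n =>
    hf.subset (hXmono (Nat.le_succ n)) (hpt _)
  choose P hP using fun n => exists_walk_in_comp _ (hpt (X n)) (hpt' n)
  refine exists_end_of_walks (fun n => pt (X n)) (fun n h => ?_) P fun Z => ?_
  · have h' : pt (X n) = pt (X (n + 1)) := h
    have := hptmem n
    rw [h'] at this
    exact SimpleGraph.ComponentCompl.notMem_of_mem (hpt (X (n + 1))) this
  · choose N hN using hempty
    -- Past all the indices `N z` the component `f (X n)` avoids `Z`, hence lies in `f Z`.
    refine ⟨Z.sup N, fun n hn v hv => hf.subset_of_avoids (fun z hz hzn => ?_) (hP n v hv)⟩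
    exact hN z (hf.subset (hXmono ((Finset.le_sup hz).trans hn)) hzn)

/-- Every direction is defined by an end. -/
theorem exists_end (hf : IsDirection f) : ∃ ω : Ends G, ∀ X, ω.comp X = f X :=
  (dominating f).finite_or_infinite.elim hf.exists_end_of_finite_dominating
    hf.exists_end_of_infinite_dominating

end IsDirection

lemma Ends.ext_comp {ω ω' : Ends G} (h : ∀ X, ω.comp X = ω'.comp X) : ω = ω' := by
  obtain ⟨r, rfl⟩ := ω.exists_ray
  obtain ⟨s, rfl⟩ := ω'.exists_ray
  refine Quotient.sound (s := raySetoid G) fun X => ⟨r.toEnd.comp X, Ends.hasTailIn_comp rfl X, ?_⟩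
  rw [h]
  exact Ends.hasTailIn_comp rfl X

/-! ### Tough graphs -/

namespace CSystem

lemma emb_injective (α : CSystem G) (X : Finset V) : Function.Injective (α.emb X) := by
  let _ : TopologicalSpace (Comp G X) := ⊥
  exact (α.isEmbedding_emb X).injective

lemma endLimit_injective (α : CSystem G) : Function.Injective α.endLimit := fun _ _ h =>
  Ends.ext_comp fun X => α.emb_injective X (congrFun (congrArg Subtype.val h) X)

/-- A finite image in a Hausdorff space is closed, and this one is dense. -/
lemma emb_surjective (α : CSystem G) (hG : IsTough G) (X : Finset V) :
    Function.Surjective (α.emb X) := by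
  have := hG X
  rw [← Set.range_eq_univ, ← (Set.finite_range (α.emb X)).isClosed.closure_eq]
  exact (α.denseRange_emb X).closure_range

lemma discreteTopology (α : CSystem G) (hG : IsTough G) (X : Finset V) :
    DiscreteTopology (α.space X) := by
  have := hG X
  have := Finite.of_surjective _ (α.emb_surjective hG X)
  infer_instance

/-- In a tough graph all `𝒞`-systems are comparable. -/
lemma le_of_isTough (α δ : CSystem G) (hG : IsTough G) : Le α δ := by
  have hl : ∀ X C, Function.surjInv (δ.emb_surjective hG X) (δ.emb X C) = C := fun X C =>
    δ.emb_injective X (Function.surjInv_eq (δ.emb_surjective hG X) _)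
  -- Both embeddings are bijective, so the comparison map is `α_X ∘ δ_X⁻¹`.
  refine ⟨fun X p => α.emb X (Function.surjInv (δ.emb_surjective hG X) p),
    fun X => ⟨?_, fun C => ?_⟩, fun X X' h p => ?_⟩
  · have := δ.discreteTopology hG X
    exact continuous_of_discreteTopology
  · exact congrArg (α.emb X) (hl X C)
  · obtain ⟨C, rfl⟩ := δ.emb_surjective hG X' p
    simp only [δ.bond_emb, hl, α.bond_emb]

/-- Every coordinate of a limit point is a component; compatibility with the bonding maps makes
these components a direction, hence an end. -/
lemma endLimit_bijective (α : CSystem G) (hG : IsTough G) : Function.Bijective α.endLimit := by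
  refine ⟨α.endLimit_injective, fun ξ => ?_⟩
  choose f hf using fun X => α.emb_surjective hG X (ξ.1 X)
  have hdir : IsDirection f := fun X X' h => α.emb_injective X (by
    rw [← α.bond_emb, hf, hf, ξ.2 X X' h])
  obtain ⟨ω, hω⟩ := hdir.exists_end
  refine ⟨ω, Subtype.ext (funext fun X => ?_)⟩
  change α.emb X (ω.comp X) = _
  rw [hω, hf]

end CSystem

/-! ### Tangles -/

lemma isSep_sepToward (X : Finset V) (𝒞 : Set (Comp G X)) : IsSep G (sepToward X 𝒞) := by
  refine ⟨X.finite_toSet.subset ?_, ?_, ?_⟩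
  · rintro v ⟨h1, h2 | h2⟩
    · exact h2
    · exact absurd h2 h1
  · ext v
    by_cases h : v ∈ vertsOf 𝒞 <;> simp [sepToward, h]
  · rintro a ⟨ha1, ha2⟩ b ⟨hb1, hb2⟩ hab
    obtain ⟨C, hC, hbC⟩ := not_not.1 hb2
    exact ha1 ⟨C, hC, SimpleGraph.ComponentCompl.mem_of_adj _ _ hbC (fun h => ha2 (Or.inl h))
      hab.symm⟩

lemma mem_endTangleSet_sepToward {ω : Ends G} {X : Finset V} {𝒞 : Set (Comp G X)} :
    sepToward X 𝒞 ∈ endTangleSet ω ↔ ω.comp X ∈ 𝒞 := by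
  obtain ⟨r, hr⟩ := ω.exists_ray
  constructor
  · intro h
    obtain ⟨v, ⟨h1, h2⟩, h3⟩ := ((hasTailIn_of_mem_endTangleSet h hr).inter
      (Ends.hasTailIn_comp hr X)).infinite.nonempty
    obtain ⟨C, hC, hvC⟩ := not_not.1 h2
    rwa [comp_eq_of_mem h3 hvC]
  · intro h
    have hsub : ∀ v ∈ ω.comp X, v ∈ vertsOf 𝒞 := fun v hv => ⟨_, h, hv⟩
    refine ⟨isSep_sepToward X 𝒞, X, ?_, fun v hv => ⟨Or.inr (hsub v hv), not_not.2 (hsub v hv)⟩⟩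
    ext v
    refine ⟨fun hv => ⟨?_, Or.inl hv⟩, ?_⟩
    · rintro ⟨C, _, hvC⟩
      exact SimpleGraph.ComponentCompl.notMem_of_mem hvC hv
    · rintro ⟨h1, h2 | h2⟩
      · exact h2
      · exact absurd h2 h1

lemma endTangle_injective : Function.Injective (endTangle (G := G)) := by
  intro ω ω' h
  refine Ends.ext_comp fun X => ?_
  have h1 : sepToward X {ω.comp X} ∈ endTangleSet ω := mem_endTangleSet_sepToward.2 rfl
  rw [show endTangleSet ω = endTangleSet ω' from congrArg Subtype.val h] at h1
  exact (mem_endTangleSet_sepToward.1 h1).symm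

/-! ### Closure properties of tangles -/

namespace IsTangle

variable {τ : Set (Set V × Set V)}

/-- A single separation is a star whose interior is its big side. -/
lemma infinite_snd (hτ : IsTangle G τ) {p : Set V × Set V} (hp : p ∈ τ) : p.2.Infinite := by
  intro hfin
  refine hτ.2.2 {p} (singleton_subset_iff.2 hp) ⟨⟨?_, ?_⟩, finite_singleton p, ?_⟩
  · rintro _ rfl
    exact hτ.1.1 _ hp
  · rintro _ rfl _ rfl h
    exact absurd rfl h
  · simpa [starInterior] using hfin

lemma infinite_univ (hτ : IsTangle G τ) : (univ : Set V).Infinite := fun hfin =>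
  hτ.2.2 ∅ (empty_subset τ) ⟨⟨by simp, by simp⟩, finite_empty, hfin.subset (subset_univ _)⟩

lemma mem_or_swap_mem (hτ : IsTangle G τ) {p : Set V × Set V} (hp : IsSep G p) :
    p ∈ τ ∨ p.swap ∈ τ :=
  (hτ.1.2 p hp).1

/-- An orientation may contain both `p` and `p.swap` only if they are equal. Both sides would then
be `V`, which is infinite because it is the interior of the empty star. -/
lemma swap_notMem (hτ : IsTangle G τ) {p : Set V × Set V} (hp : p ∈ τ) : p.swap ∉ τ := by
  intro hps
  obtain ⟨h1, h2, _⟩ := hτ.1.1 p hp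
  have h : p.1 = p.2 := congrArg Prod.fst ((hτ.1.2 p (hτ.1.1 p hp)).2 hp hps)
  rw [h, inter_self] at h1
  rw [h, union_self] at h2
  exact hτ.infinite_univ (h2 ▸ h1)

lemma mem_of_le (hτ : IsTangle G τ) {p q : Set V × Set V} (hq : q ∈ τ) (hp : IsSep G p)
    (hle : SepLE p q) : p ∈ τ := by
  by_contra hpn
  have hps := (hτ.mem_or_swap_mem hp).resolve_left hpn
  -- Consistency constrains only distinct members. If `p.swap = q`, then `p ≤ p.swap` forces `p.2 =
  -- V`, so the big side `p.1` of `q` is the finite separator.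
  by_cases hne : p.swap = q
  · subst hne
    have huniv : p.2 = univ := by
      rw [← hp.2.1]
      exact (union_eq_right.2 hle.1).symm
    have hfin := hp.1
    rw [huniv, inter_univ] at hfin
    exact hτ.infinite_snd hq hfin
  · refine hτ.2.1 _ hps q hq hne ⟨by simpa using hle, fun h => hpn ?_⟩
    rw [Prod.swap_swap] at h
    rwa [h]

/-- If the supremum were oriented the other way, `(A, B)`, `(B ∩ C, A ∪ D)` and `(B ∩ D, A ∪ C)`
would form a star in `τ` with interior inside the finite set `(A ∩ B) ∪ (C ∩ D)`. The middle member
replaces `(C, D)`, which may cross `(A, B)`; it lies in `τ` because it is below `(C, D)`. -/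
lemma sup_mem (hτ : IsTangle G τ) {p q : Set V × Set V} (hp : p ∈ τ) (hq : q ∈ τ) :
    (p.1 ∪ q.1, p.2 ∩ q.2) ∈ τ := by
  obtain ⟨A, B⟩ := p
  obtain ⟨C, D⟩ := q
  obtain ⟨hp1, hp2, hp3⟩ := hτ.1.1 _ hp
  obtain ⟨hq1, hq2, hq3⟩ := hτ.1.1 _ hq
  simp only at *
  have hu1 : ∀ v, v ∈ A ∨ v ∈ B := fun v => (hp2 ▸ mem_univ v : v ∈ A ∪ B)
  have hu2 : ∀ v, v ∈ C ∨ v ∈ D := fun v => (hq2 ▸ mem_univ v : v ∈ C ∪ D)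
  have hfin : (A ∩ B ∪ C ∩ D).Finite := hp1.union hq1
  have hsep1 : IsSep G (B ∩ C, A ∪ D) := by
    refine ⟨hfin.subset ?_, ?_, ?_⟩
    · rintro v ⟨⟨_, _⟩, _ | _⟩ <;> simp_all
    · ext v
      have := hu1 v
      have := hu2 v
      simp only [mem_union, mem_inter_iff, mem_univ, iff_true]
      tauto
    · rintro a ⟨⟨ha1, ha2⟩, ha3⟩ b ⟨hb1, hb2⟩ hab
      simp only [mem_union, mem_inter_iff, not_or, not_and_or] at ha3 hb2
      by_cases hbB : b ∈ B
      · have hbC := hb2.resolve_left (not_not.2 hbB)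
        exact hq3 a ⟨ha2, ha3.2⟩ b ⟨(hu2 b).resolve_left hbC, hbC⟩ hab
      · exact hp3 b ⟨(hu1 b).resolve_right hbB, hbB⟩ a ⟨ha1, ha3.1⟩ hab.symm
  have hsep2 : IsSep G (A ∪ C, B ∩ D) := by
    refine ⟨hfin.subset ?_, ?_, ?_⟩
    · rintro v ⟨_ | _, _, _⟩ <;> simp_all
    · ext v
      have := hu1 v
      have := hu2 v
      simp only [mem_union, mem_inter_iff, mem_univ, iff_true]
      tauto
    · rintro a ⟨ha1, ha2⟩ b ⟨⟨hb1, hb2⟩, hb3⟩ hab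
      simp only [mem_union, mem_inter_iff, not_or, not_and_or] at ha2 hb3
      rcases ha2 with ha2 | ha2
      · exact hp3 a ⟨(hu1 a).resolve_right ha2, ha2⟩ b ⟨hb1, hb3.1⟩ hab
      · exact hq3 a ⟨(hu2 a).resolve_right ha2, ha2⟩ b ⟨hb2, hb3.2⟩ hab
  have h1 : (B ∩ C, A ∪ D) ∈ τ :=
    hτ.mem_of_le hq hsep1 ⟨inter_subset_right, subset_union_right⟩
  by_contra hcon
  have h2 : (B ∩ D, A ∪ C) ∈ τ := (hτ.mem_or_swap_mem hsep2).resolve_left hcon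
  refine hτ.2.2 {(A, B), (B ∩ C, A ∪ D), (B ∩ D, A ∪ C)} ?_ ⟨⟨?_, ?_⟩, by simp, hfin.subset ?_⟩
  · rintro _ (rfl | rfl | rfl) <;> assumption
  · rintro _ (rfl | rfl | rfl)
    exacts [hτ.1.1 _ hp, hsep1, hsep2.swap]
  · have ha : B ∩ C ⊆ A ∪ C := fun v hv => Or.inr hv.2
    have hb : B ∩ D ⊆ A ∪ D := fun v hv => Or.inr hv.2
    rintro _ (rfl | rfl | rfl) _ (rfl | rfl | rfl) hne <;>
      first
        | exact absurd rfl hne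
        | exact ⟨subset_union_left, inter_subset_left⟩
        | exact ⟨inter_subset_left, subset_union_left⟩
        | exact ⟨ha, hb⟩
        | exact ⟨hb, ha⟩
  · intro v hv
    simp only [starInterior, mem_insert_iff, mem_singleton_iff, iInter_iInter_eq_or_left,
      iInter_iInter_eq_left, mem_inter_iff, mem_union] at hv ⊢
    tauto

/-- Otherwise the separations pointing away from the single components form a finite star in `τ`
whose interior is `X`. -/
lemma exists_sepToward_singleton_mem (hτ : IsTangle G τ) (X : Finset V) [Finite (Comp G X)] :
    ∃ C : Comp G X, sepToward X {C} ∈ τ := by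
  by_contra! hcon
  have hmem : ∀ C : Comp G X, (sepToward X {C}).swap ∈ τ := fun C =>
    (hτ.mem_or_swap_mem (isSep_sepToward X {C})).resolve_left (hcon C)
  refine hτ.2.2 (range fun C : Comp G X => (sepToward X {C}).swap) ?_
    ⟨⟨?_, ?_⟩, finite_range _, X.finite_toSet.subset ?_⟩
  · rintro _ ⟨C, rfl⟩
    exact hmem C
  · rintro _ ⟨C, rfl⟩
    exact (isSep_sepToward X {C}).swap
  · rintro _ ⟨C, rfl⟩ _ ⟨D, rfl⟩ hne
    have hCD : C ≠ D := fun h => hne (by rw [h])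
    have key : ∀ {C D : Comp G X}, C ≠ D → (X : Set V) ∪ vertsOf {C} ⊆ (vertsOf {D})ᶜ := by
      rintro C D hCD v hv ⟨_, rfl, hvD⟩
      rcases hv with hv | ⟨_, rfl, hvC⟩
      · exact SimpleGraph.ComponentCompl.notMem_of_mem hvD hv
      · exact hCD (comp_eq_of_mem hvC hvD)
    exact ⟨key hCD, key hCD.symm⟩
  · intro v hv
    by_contra hvX
    simp only [starInterior, mem_range, iInter_exists, iInter_iInter_eq', mem_iInter] at hv
    exact hv (G.componentComplMk hvX) ⟨_, rfl, hvX, rfl⟩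

/-- In a tough graph every tangle is an end tangle. -/
lemma exists_end (hτ : IsTangle G τ) (hG : IsTough G) : ∃ ω : Ends G, endTangleSet ω = τ := by
  classical
  choose f hf using fun X => have := hG X; hτ.exists_sepToward_singleton_mem X
  have hdir : IsDirection f := by
    intro X X' h
    by_contra hne
    -- Were the choices incompatible, `f X` and `f X'` would be disjoint, and the supremum of the
    -- two separations would have its big side inside `X'`.
    refine hτ.infinite_snd (hτ.sup_mem (hf X) (hf X')) (X'.finite_toSet.subset ?_)
    rintro v ⟨h1 | ⟨_, rfl, h1⟩, h2 | ⟨_, rfl, h2⟩⟩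
    · exact h2
    · exact h h1
    · exact h2
    · exact absurd (comp_eq_of_mem (subset_compMap G h _ h2) h1) hne
  obtain ⟨ω, hω⟩ := hdir.exists_end
  have hsub : endTangleSet ω ⊆ τ := by
    rintro p ⟨hp, X, hX, hsub⟩
    rw [hω] at hsub
    refine hτ.mem_of_le (hf X) hp ⟨fun v hv => ?_, ?_⟩
    · rintro ⟨_, rfl, hvC⟩
      exact (hsub hvC).2 hv
    · rintro v (hv | ⟨_, rfl, hv⟩)
      · rw [hX] at hv
        exact hv.2
      · exact (hsub hv).1
  -- Inclusion suffices for equality: both tangles orient every separation, and `τ` never both ways.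
  refine ⟨ω, hsub.antisymm fun p hp => ?_⟩
  refine ((isTangle_endTangleSet ω).mem_or_swap_mem (hτ.1.1 p hp)).resolve_right fun h => ?_
  exact hτ.swap_notMem hp (hsub h)

end IsTangle

lemma endTangle_bijective (hG : IsTough G) : Function.Bijective (endTangle (G := G)) :=
  ⟨endTangle_injective, fun τ => (τ.2.exists_end hG).imp fun _ h => Subtype.ext h⟩

/-! ### Graphs that are not tough -/

/-- Neighbourhoods of components of `G - X` are among the finitely many subsets of `X`, so if there
are infinitely many components, infinitely many share one neighbourhood. -/
lemma exists_critical (hG : ¬ IsTough G) : ∃ Y : Finset V, IsCritical G Y := by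
  by_contra! hcon
  refine hG fun X => Set.finite_univ_iff.1 ?_
  have : (univ : Set (Comp G X)) ⊆ ⋃ Y ∈ (X.powerset : Set (Finset V)), compsWithNbhd G X Y := by
    intro C _
    obtain ⟨Y, hY⟩ := (X.finite_toSet.subset (nbhd_subset C)).exists_finset_coe
    simp only [mem_iUnion]
    refine ⟨Y, ?_, hY.symm⟩
    have h := nbhd_subset C
    rw [← hY] at h
    simpa using h
  refine (X.powerset.finite_toSet.biUnion fun Y hY => ?_).subset this
  by_contra hinf
  exact hcon Y ((compsWithNbhd_infinite_iff (by simpa using hY)).1 hinf)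

lemma exists_infinite_inter_sdiff {α : Type*} {S : Set α} (hS : S.Infinite) :
    ∃ A : Set α, (S ∩ A).Infinite ∧ (S \ A).Infinite := by
  let e := hS.natEmbedding
  have hinj : Function.Injective fun n => (e n : α) := fun a b h => e.injective (Subtype.ext h)
  refine ⟨range fun n => (e (2 * n) : α), ?_, ?_⟩
  · refine infinite_of_injective_forall_mem (f := fun n => (e (2 * n) : α)) (fun a b h => ?_)
      fun n => ⟨(e _).2, n, rfl⟩
    have := hinj h
    omega
  · refine infinite_of_injective_forall_mem (f := fun n => (e (2 * n + 1) : α)) (fun a b h => ?_)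
      fun n => ⟨(e _).2, ?_⟩
    · have := hinj h
      omega
    · rintro ⟨m, hm⟩
      have := hinj hm
      omega

/-- Continuity at the point `Y` of `Γ_Y` forces every member of its image ultrafilter to contain
almost all components with neighbourhood `Y`. But the ultrafilter must contain `A` or its
complement, each of which misses infinitely many of them. -/
lemma isTough_of_ultrafilterSystem_le
    (h : CSystem.Le (ultrafilterSystem G) (gammaSystem G)) : IsTough G := by
  by_contra hG
  obtain ⟨Y, hY⟩ := exists_critical hG
  obtain ⟨g, hg, _⟩ := h
  obtain ⟨hcont, hemb⟩ := hg Y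
  obtain ⟨A, hA, hA'⟩ := exists_infinite_inter_sdiff hY
  let y : GammaSpace G Y := GammaSpace.crit Y hY (Finset.Subset.refl Y)
  have key : ∀ B : Set (Comp G Y), (compsWithNbhd G Y Y \ B).Infinite →
      B ∉ (show Ultrafilter (Comp G Y) from g Y y) := by
    intro B hB hmem
    have hopen : IsOpen (X := GammaSpace G Y)
        (g Y ⁻¹' {W : Ultrafilter (Comp G Y) | B ∈ W}) :=
      (ultrafilter_isOpen_basic B).preimage hcont
    refine hB ((gamma_isOpen_iff.1 hopen Y hY (Finset.Subset.refl Y) hmem).subset ?_)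
    rintro C ⟨hC, hCB⟩
    refine ⟨hC, fun hmem' => hCB ?_⟩
    have h2 : g Y (GammaSpace.comp C) = (pure C : Ultrafilter (Comp G Y)) := hemb C
    have h1 : g Y (GammaSpace.comp C) ∈ {W : Ultrafilter (Comp G Y) | B ∈ W} := hmem'
    rw [h2] at h1
    exact h1
  rcases (show Ultrafilter (Comp G Y) from g Y y).mem_or_compl_mem A with h | h
  · exact key A hA' h
  · refine key Aᶜ ?_ h
    rwa [Set.sdiff_compl]

open Classical in
/-- The point of `Γ` defined by a critical set. -/
noncomputable def critLimit {Y : Finset V} (hY : IsCritical G Y) : (gammaSystem G).Limit :=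
  ⟨fun X => if h : Y ⊆ X then GammaSpace.crit Y hY h else GammaSpace.comp (compMeeting G h), by
    intro X X' h
    by_cases hX' : Y ⊆ X'
    · by_cases hX : Y ⊆ X <;> simp [gammaSystem, gammaBond, hX, hX']
    · have hX : ¬ Y ⊆ X := fun hs => hX' (hs.trans h)
      obtain ⟨y, hyY, hy⟩ := exists_mem_compMeeting G hX'
      simp [gammaSystem, gammaBond, hX, hX', compMeeting_eq hX hY hyY (subset_compMap G h _ hy)]⟩

lemma critLimit_of_subset {X Y : Finset V} (hY : IsCritical G Y) (h : Y ⊆ X) :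
    (critLimit hY).1 X = GammaSpace.crit Y hY h := by
  exact dif_pos h

lemma critLimit_of_not_subset {X Y : Finset V} (hY : IsCritical G Y) (h : ¬ Y ⊆ X) :
    (critLimit hY).1 X = GammaSpace.comp (compMeeting G h) := by
  exact dif_neg h

/-- The limit point of a critical set `Y` has `Y` itself as its coordinate at `Y`, whereas all
coordinates of an end are components. -/
lemma isTough_of_gamma_endLimit_surjective
    (h : Function.Surjective (gammaSystem G).endLimit) : IsTough G := by
  by_contra hG
  obtain ⟨Y, hY⟩ := exists_critical hG
  obtain ⟨ω, hω⟩ := h (critLimit hY)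
  have h1 := (congrFun (congrArg Subtype.val hω) Y).trans
    (critLimit_of_subset hY (Finset.Subset.refl Y))
  have h2 : (GammaSpace.comp (ω.comp Y) : GammaSpace G Y) =
    GammaSpace.crit Y hY (Finset.Subset.refl Y) := h1
  cases h2

/-! ### Tangles from free ultrafilters -/

/-- The finite order separations whose big side includes `𝒰`-many components of `G - X`. -/
def ultrafilterTangleSet {X : Finset V} (𝒰 : Ultrafilter (Comp G X)) : Set (Set V × Set V) :=
  {p | IsSep G p ∧ {C : Comp G X | (C : Set V) ⊆ p.2 \ p.1} ∈ 𝒰}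

lemma comp_subset_side_of_avoids {p : Set V × Set V} (hp : IsSep G p) {X : Finset V}
    (C : Comp G X) (hC : ∀ v ∈ p.1 ∩ p.2, v ∉ C) {v : V} (hv : v ∈ C) (hvp : v ∈ p.2 \ p.1) :
    (C : Set V) ⊆ p.2 \ p.1 := by
  refine comp_subset_of_closed C _ hv hvp fun a b _ ha hb hab => ?_
  have hbu : b ∈ p.1 ∪ p.2 := hp.2.1 ▸ mem_univ b
  by_cases hb2 : b ∈ p.2
  · exact ⟨hb2, fun h => hC b ⟨h, hb2⟩ hb⟩
  · exact absurd hab.symm (hp.2.2 b ⟨hbu.resolve_right hb2, hb2⟩ a ha)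

/-- As `𝒰` is free, `𝒰`-many components avoid any given finite separator, so each of them lies
strictly on one side, and `𝒰` decides which. A finite star in the set has `𝒰`-many components inside
its interior, while a finite interior would be avoided by `𝒰`-many. -/
lemma isTangle_ultrafilterTangleSet {X : Finset V} (𝒰 : Ultrafilter (Comp G X))
    (h𝒰 : (𝒰 : Filter (Comp G X)) ≤ Filter.cofinite) : IsTangle G (ultrafilterTangleSet 𝒰) := by
  refine ⟨⟨fun p hp => hp.1, fun p hp => ⟨?_, ?_⟩⟩, ?_, ?_⟩
  · obtain ⟨Z, hZ⟩ := hp.1.exists_finset_coe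
    have hcof : {C : Comp G X | ∀ v ∈ p.1 ∩ p.2, v ∉ C} ∈ 𝒰 := by
      refine h𝒰 (Filter.mem_cofinite.2 ((finite_comps_meeting G Z X).subset fun C hC => ?_))
      simp only [mem_compl_iff, mem_ofPred_eq, not_forall, not_not, ← hZ] at hC
      obtain ⟨v, hv, hvC⟩ := hC
      exact ⟨v, hv, hvC⟩
    rcases 𝒰.mem_or_compl_mem {C : Comp G X | (C : Set V) ⊆ p.2 \ p.1} with h | h
    · exact Or.inl ⟨hp, h⟩
    · refine Or.inr ⟨hp.swap, 𝒰.toFilter.mem_of_superset (Filter.inter_mem hcof h) ?_⟩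
      rintro C ⟨hC1, hC2⟩
      have hswap : ∀ v ∈ p.swap.1 ∩ p.swap.2, v ∉ C := fun v hv => hC1 v ⟨hv.2, hv.1⟩
      obtain ⟨v, hv⟩ := SimpleGraph.ComponentCompl.nonempty C
      have hvu : v ∈ p.1 ∪ p.2 := hp.2.1 ▸ mem_univ v
      by_cases hv2 : v ∈ p.2
      · exact absurd (comp_subset_side_of_avoids hp C hC1 hv ⟨hv2, fun h => hC1 v ⟨h, hv2⟩ hv⟩) hC2
      · exact comp_subset_side_of_avoids hp.swap C hswap hv ⟨hvu.resolve_right hv2, hv2⟩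
  · rintro ⟨_, h1⟩ ⟨_, h2⟩
    obtain ⟨C, hC1, hC2⟩ := 𝒰.neBot.nonempty_of_mem (Filter.inter_mem h1 h2)
    obtain ⟨v, hv⟩ := SimpleGraph.ComponentCompl.nonempty C
    exact absurd (hC1 hv).1 (hC2 hv).2
  · rintro p ⟨_, h1⟩ q ⟨_, h2⟩ _ ⟨hle, _⟩
    obtain ⟨C, hC1, hC2⟩ := 𝒰.neBot.nonempty_of_mem (Filter.inter_mem h1 h2)
    obtain ⟨v, hv⟩ := SimpleGraph.ComponentCompl.nonempty C
    exact (hC2 hv).2 (hle.1 (hC1 hv).1)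
  · rintro σ hσ ⟨_, hfin, hint⟩
    have hmem : (⋂ p ∈ σ, {C : Comp G X | (C : Set V) ⊆ p.2 \ p.1}) ∈ (𝒰 : Filter (Comp G X)) :=
      (Filter.biInter_mem hfin).2 fun p hp => (hσ hp).2
    obtain ⟨Z, hZ⟩ := hint.exists_finset_coe
    have hcof : {D : Comp G X | ∃ x ∈ Z, x ∈ D}ᶜ ∈ (𝒰 : Filter (Comp G X)) :=
      h𝒰 (finite_comps_meeting G Z X).compl_mem_cofinite
    obtain ⟨C, hC1, hC2⟩ := 𝒰.neBot.nonempty_of_mem (Filter.inter_mem hmem hcof)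
    obtain ⟨v, hv⟩ := SimpleGraph.ComponentCompl.nonempty C
    refine hC2 ⟨v, ?_, hv⟩
    rw [← Finset.mem_coe, hZ]
    simp only [starInterior, mem_iInter] at hC1 ⊢
    exact fun p hp => (hC1 p hp hv).1

/-- An end tangle points towards the single component `C(X, ω)`. The tangle of a free ultrafilter on
`Comp G X` points to no single component. -/
lemma isTough_of_endTangle_surjective (h : Function.Surjective (endTangle (G := G))) :
    IsTough G := by
  intro X
  by_contra hinf
  have : Infinite (Comp G X) := not_finite_iff_infinite.1 hinf
  obtain ⟨ω, hω⟩ := h ⟨_, isTangle_ultrafilterTangleSet (Filter.hyperfilter (Comp G X))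
    Filter.hyperfilter_le_cofinite⟩
  have h1 : sepToward X {ω.comp X} ∈ endTangleSet ω := mem_endTangleSet_sepToward.2 rfl
  rw [show endTangleSet ω = _ from congrArg Subtype.val hω] at h1
  refine Filter.notMem_hyperfilter_of_finite ((finite_singleton (ω.comp X)).subset ?_) h1.2
  intro C hC
  obtain ⟨v, hv⟩ := SimpleGraph.ComponentCompl.nonempty C
  obtain ⟨_, rfl, hv'⟩ := not_not.1 (hC hv).2
  exact comp_eq_of_mem hv hv'

/-! ### Topological equivalence -/

lemma vert_mem_compRegion {X : Finset V} {𝒞 : Set (Comp G X)} {v : V} :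
    OneComplex.vert v ∈ compRegion X 𝒞 ↔ v ∈ vertsOf 𝒞 := by
  constructor
  · rintro (⟨w, hw, h⟩ | ⟨e, t, h, _⟩)
    · cases h
      exact hw
    · cases h
  · exact fun h => Or.inl ⟨v, h, rfl⟩

/-- Every neighbourhood in `|G|_Γ` of the point defined by a critical set `Y` includes the vertex
sets of all but finitely many of the components with neighbourhood `Y`. -/
lemma finite_not_subset_of_critLimit_mem {Y : Finset V} (hY : IsCritical G Y)
    {W : Set (gammaSystem G).Extension} (hW : IsOpen W)
    (hmem : CSystem.Extension.ofLimit (critLimit hY) ∈ W) :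
    {C ∈ compsWithNbhd G Y Y |
      ¬ ∀ v ∈ C, CSystem.Extension.ofGraph (OneComplex.vert v) ∈ W}.Finite := by
  induction hW with
  | basic S hS =>
    rcases hS with ⟨U, _, rfl⟩ | ⟨X, O, hO, rfl⟩
    · obtain ⟨p, _, hp⟩ := hmem
      cases hp
    · rcases hmem with ⟨p, _, hp⟩ | ⟨_, hξ, hp⟩
      · cases hp
      cases hp
      have hvert : ∀ (C : Comp G X), GammaSpace.comp C ∈ O → ∀ v ∈ C,
          (CSystem.Extension.ofGraph (OneComplex.vert v) : (gammaSystem G).Extension) ∈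
            (gammaSystem G).nhd X O := fun C hC v hv =>
        Or.inl ⟨_, vert_mem_compRegion.2 ⟨C, hC, hv⟩, rfl⟩
      have hmeet := finite_comps_meeting G X Y
      by_cases hYX : Y ⊆ X
      · have hcrit : GammaSpace.crit Y hY hYX ∈ O := by
          rw [← critLimit_of_subset hY hYX]
          exact hξ
        have hfin := gamma_isOpen_iff.1 hO Y hY hYX hcrit
        refine (hmeet.union (hfin.image (compMap G hYX))).subset ?_
        rintro D ⟨hD, hDW⟩
        by_cases hDX : ∃ x ∈ X, x ∈ D
        · exact Or.inl hDX
        · push Not at hDX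
          -- As `Y ⊆ X`, a component of `G - Y` avoiding `X` is also a component of `G - X`, with
          -- the same neighbourhood.
          obtain ⟨C, hDC⟩ := exists_comp_of_avoids D hDX
          obtain ⟨v, hv⟩ := SimpleGraph.ComponentCompl.nonempty D
          have hCD : compMap G hYX C = D :=
            comp_eq_of_mem (subset_compMap G hYX C (hDC hv)) hv
          have hCeq : (C : Set V) = D := Subset.antisymm (hCD ▸ subset_compMap G hYX C) hDC
          refine Or.inr ⟨C, ⟨?_, fun hC => hDW fun w hw => hvert C hC w (hDC hw)⟩, hCD⟩
          change nbhd G (C : Set V) = _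
          rw [hCeq]
          exact hD
      -- Here `Y` has a vertex outside `X`. Every component of `G - Y` with neighbourhood `Y` that
      -- avoids `X` is attached to this vertex, so it lies in the component of `G - X` meeting `Y`.
      · have hcomp : GammaSpace.comp (compMeeting G hYX) ∈ O := by
          rw [← critLimit_of_not_subset hY hYX]
          exact hξ
        refine hmeet.subset ?_
        rintro D ⟨hD, hDW⟩
        by_contra hDX
        have hDX' : ∀ x ∈ X, x ∉ D := fun x hx hxD => hDX ⟨x, hx, hxD⟩
        obtain ⟨C, hDC⟩ := exists_comp_of_avoids D hDX'
        obtain ⟨y, hyY, hyX⟩ := Finset.not_subset.1 hYX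
        have hy : y ∈ nbhd G (D : Set V) := by
          rw [show nbhd G (D : Set V) = (Y : Set V) from hD]
          exact hyY
        obtain ⟨_, c, hc, hcy⟩ := hy
        have hyC : y ∈ C := SimpleGraph.ComponentCompl.mem_of_adj _ _ (hDC hc) hyX hcy
        rw [compMeeting_eq hYX hY hyY hyC] at hcomp
        exact hDW fun w hw => hvert C hcomp w (hDC hw)
  | univ => simp
  | inter S T _ _ ihS ihT =>
    refine ((ihS hmem.1).union (ihT hmem.2)).subset ?_
    rintro C ⟨hC1, hC2⟩
    by_contra hcon
    simp only [mem_union, mem_ofPred_eq, hC1, true_and, not_or, not_not] at hcon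
    exact hC2 fun v hv => ⟨hcon.1 v hv, hcon.2 v hv⟩
  | sUnion 𝒮 _ ih =>
    obtain ⟨S, hS, hmem⟩ := hmem
    refine (ih S hS hmem).subset ?_
    rintro C ⟨hC1, hC2⟩
    exact ⟨hC1, fun h => hC2 fun v hv => ⟨S, hS, h v hv⟩⟩

lemma swap_sepToward (X : Finset V) (𝒞 : Set (Comp G X)) :
    (sepToward X 𝒞).swap = sepToward X 𝒞ᶜ := by
  have key : ∀ v, v ∈ vertsOf 𝒞ᶜ ↔ v ∉ X ∧ v ∉ vertsOf 𝒞 := by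
    intro v
    constructor
    · rintro ⟨C, hC, hvC⟩
      refine ⟨SimpleGraph.ComponentCompl.notMem_of_mem hvC, ?_⟩
      rintro ⟨D, hD, hvD⟩
      exact hC (comp_eq_of_mem hvD hvC ▸ hD)
    · rintro ⟨hvX, hv⟩
      exact ⟨G.componentComplMk hvX, fun h => hv ⟨_, h, hvX, rfl⟩, hvX, rfl⟩
  have hX : ∀ v ∈ X, v ∉ vertsOf 𝒞 := by
    rintro v hvX ⟨C, _, hvC⟩
    exact SimpleGraph.ComponentCompl.notMem_of_mem hvC hvX
  refine Prod.ext (Set.ext fun v => ?_) (Set.ext fun v => ?_)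
  · simp only [sepToward, Prod.fst_swap, mem_union, Finset.mem_coe, mem_compl_iff, key]
    tauto
  · have := hX v
    simp only [sepToward, Prod.snd_swap, mem_union, Finset.mem_coe, mem_compl_iff, key]
    tauto

/-- The homeomorphism fixes `G`, so the point of a critical set `Y` comes from a tangle `τ`. If `τ`
points towards `𝒟`, the image of `tangleNhd Y 𝒟` is a neighbourhood of that point, so it contains
the vertices of almost all components with neighbourhood `Y`; as vertices are fixed, these
components lie in `𝒟`. But `τ` points towards `A` or its complement. -/
lemma isTough_of_topEquivalent
    (h : TopEquivalent (gammaSystem G).ofEndExtension (tangleOfEndExtension (G := G))) :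
    IsTough G := by
  by_contra hG
  obtain ⟨Y, hY⟩ := exists_critical hG
  obtain ⟨f, hf⟩ := h
  have hgraph : ∀ p, f (.ofGraph p) = .ofGraph p := fun p => hf (.ofGraph p)
  obtain ⟨τ, hτ⟩ : ∃ τ, f (.ofTangle τ) = .ofLimit (critLimit hY) := by
    obtain ⟨x, hx⟩ := f.surjective (.ofLimit (critLimit hY))
    rcases x with p | τ
    · rw [hgraph] at hx
      cases hx
    · exact ⟨τ, hx⟩
  have key : ∀ 𝒟 : Set (Comp G Y), (compsWithNbhd G Y Y \ 𝒟).Infinite →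
      sepToward Y 𝒟 ∉ τ.1 := by
    intro 𝒟 h𝒟 hmem
    have hopen : IsOpen (tangleNhd Y 𝒟) :=
      TopologicalSpace.isOpen_generateFrom_of_mem (Or.inr ⟨Y, 𝒟, rfl⟩)
    have hW : IsOpen (f.symm ⁻¹' tangleNhd Y 𝒟) := hopen.preimage f.symm.continuous
    refine h𝒟 ((finite_not_subset_of_critLimit_mem hY hW ?_).subset ?_)
    · rw [mem_preimage, ← hτ, f.symm_apply_apply]
      exact Or.inr ⟨τ, hmem, rfl⟩
    · rintro C ⟨hC, hC𝒟⟩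
      refine ⟨hC, fun hall => hC𝒟 ?_⟩
      obtain ⟨v, hv⟩ := SimpleGraph.ComponentCompl.nonempty C
      have h1 := hall v hv
      rw [mem_preimage, ← hgraph, f.symm_apply_apply] at h1
      rcases h1 with ⟨p, hp, hpv⟩ | ⟨_, _, hp⟩
      · cases hpv
        obtain ⟨D, hD, hvD⟩ := vert_mem_compRegion.1 hp
        rwa [comp_eq_of_mem hv hvD]
      · cases hp
  obtain ⟨A, hA, hA'⟩ := exists_infinite_inter_sdiff hY
  rcases τ.2.mem_or_swap_mem (isSep_sepToward Y A) with h | h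
  · exact key A hA' h
  · rw [swap_sepToward] at h
    refine key Aᶜ ?_ h
    rwa [Set.sdiff_compl]

/-- All added points on both sides are ends, and an end lies in a basic neighbourhood on either side
exactly when its component of `G - X` belongs to the given set of components. -/
lemma topEquivalent_of_isTough (hG : IsTough G) :
    TopEquivalent (gammaSystem G).ofEndExtension (tangleOfEndExtension (G := G)) := by
  let eT : Ends G ≃ Tangles G := Equiv.ofBijective _ (endTangle_bijective hG)
  let eL : Ends G ≃ (gammaSystem G).Limit :=
    Equiv.ofBijective _ ((gammaSystem G).endLimit_bijective hG)
  let e : TangleCompactification G ≃ (gammaSystem G).Extension :=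
    { toFun := fun
        | .ofGraph p => .ofGraph p
        | .ofTangle τ => .ofLimit (eL (eT.symm τ))
      invFun := fun
        | .ofGraph p => .ofGraph p
        | .ofLimit ξ => .ofTangle (eT (eL.symm ξ))
      left_inv := by rintro (p | τ) <;> simp
      right_inv := by rintro (p | ξ) <;> simp }
  have hgraph : ∀ p, e (.ofGraph p) = .ofGraph p := fun _ => rfl
  have hend : ∀ ω, e (.ofTangle (endTangle ω)) = .ofLimit ((gammaSystem G).endLimit ω) := fun ω =>
    congrArg (fun ω' => CSystem.Extension.ofLimit (eL ω')) (eT.symm_apply_apply ω)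
  have hopenG : ∀ U : Set (OneComplex G),
      e ⁻¹' (CSystem.Extension.ofGraph '' U) = TangleCompactification.ofGraph '' U := by
    intro U
    ext x
    rcases x with p | τ
    · simp [hgraph]
    · obtain ⟨ω, rfl⟩ := eT.surjective τ
      have : e (.ofTangle (eT ω)) = .ofLimit ((gammaSystem G).endLimit ω) := hend ω
      simp [this]
  have hnhd : ∀ (X : Finset V) (O : Set (GammaSpace G X)),
      e ⁻¹' ((gammaSystem G).nhd X O) = tangleNhd X (GammaSpace.comp ⁻¹' O) := by
    intro X O
    ext x
    rcases x with p | τ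
    · simp [hgraph, CSystem.nhd, tangleNhd]
      rfl
    · obtain ⟨ω, rfl⟩ := eT.surjective τ
      have h1 : e (.ofTangle (eT ω)) = .ofLimit ((gammaSystem G).endLimit ω) := hend ω
      have h2 : sepToward X (GammaSpace.comp ⁻¹' O) ∈ (eT ω).1 ↔ _ :=
        mem_endTangleSet_sepToward
      simp [h1, CSystem.nhd, tangleNhd, h2]
      rfl
  have hcont : Continuous e := by
    refine continuous_generateFrom_iff.2 ?_
    rintro _ (⟨U, hU, rfl⟩ | ⟨X, O, hO, rfl⟩)
    · rw [hopenG]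
      exact TopologicalSpace.isOpen_generateFrom_of_mem (Or.inl ⟨U, hU, rfl⟩)
    · exact TopologicalSpace.isOpen_generateFrom_of_mem (Or.inr ⟨X, _, hnhd X O⟩)
  have hcont' : Continuous e.symm := by
    refine continuous_generateFrom_iff.2 ?_
    rintro _ (⟨U, hU, rfl⟩ | ⟨X, 𝒞, rfl⟩)
    · rw [← hopenG, ← preimage_comp, e.self_comp_symm, preimage_id]
      exact TopologicalSpace.isOpen_generateFrom_of_mem (Or.inl ⟨U, hU, rfl⟩)
    -- Every set of components is open in `Γ_X`, so `tangleNhd X 𝒞` comes from the open set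
    -- `GammaSpace.comp '' 𝒞`.
    · have hinj : Function.Injective (GammaSpace.comp (G := G) (X := X)) :=
        (gammaSystem G).emb_injective X
      rw [← preimage_image_eq 𝒞 hinj, ← hnhd, ← preimage_comp, e.self_comp_symm, preimage_id]
      exact TopologicalSpace.isOpen_generateFrom_of_mem
        (Or.inr ⟨X, _, gamma_isOpen_comp 𝒞, rfl⟩)
  refine ⟨⟨e, hcont, hcont'⟩, ?_⟩
  rintro (p | ω)
  · rfl
  · exact hend ω

end EndsTangles

theorem theorem7p8 {V : Type u} (G : SimpleGraph V) :
    List.TFAE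
      [ -- (i) `|G|_Γ` and `|G|_Θ` are topologically equivalent
        EndsTangles.TopEquivalent (EndsTangles.gammaSystem G).ofEndExtension
          (EndsTangles.tangleOfEndExtension (G := G)),
        -- (ii) `𝒞^Γ` and `𝒞^𝒰` are `𝒞`-equivalent
        EndsTangles.CSystem.Equivalent (EndsTangles.gammaSystem G)
          (EndsTangles.ultrafilterSystem G),
        -- (iii) `G` is tough
        EndsTangles.IsTough G,
        -- (iv) `Ω = Γ = 𝒰`
        Function.Bijective (EndsTangles.gammaSystem G).endLimit ∧
          Function.Bijective (EndsTangles.ultrafilterSystem G).endLimit,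
        -- (iv, in terms of tangles) `Ω = Θ`
        Function.Bijective (EndsTangles.endTangle (G := G)) ] := by
  tfae_have 3 → 1 := EndsTangles.topEquivalent_of_isTough
  tfae_have 1 → 3 := EndsTangles.isTough_of_topEquivalent
  tfae_have 3 → 2 := fun h =>
    ⟨EndsTangles.CSystem.le_of_isTough _ _ h, EndsTangles.CSystem.le_of_isTough _ _ h⟩
  tfae_have 2 → 3 := fun h => EndsTangles.isTough_of_ultrafilterSystem_le h.2
  tfae_have 3 → 4 := fun h =>
    ⟨EndsTangles.CSystem.endLimit_bijective _ h, EndsTangles.CSystem.endLimit_bijective _ h⟩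
  tfae_have 4 → 3 := fun h => EndsTangles.isTough_of_gamma_endLimit_surjective h.1.surjective
  tfae_have 3 → 5 := EndsTangles.endTangle_bijective
  tfae_have 5 → 3 := fun h => EndsTangles.isTough_of_endTangle_surjective h.surjective
  tfae_finish
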